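/- An instance of the Max-Buying-PL-Limited Problem (max-buying with limited supply and a price ladder) consists of items $1,\dots,n$, with $C_i\in\mathbb{Z}_{\ge 0}$ copies of item $i$, and $m$ bidders, where bidder $b$ has a valuation $v_{ib}\in\mathbb{Z}_{\ge 0}$ for item $i$. A feasible solution is a pricing $p\in\mathbb{Q}_{\ge 0}^n$ with $p_1\ge p_2\ge\dots\ge p_n$ together with an allocation that gives each bidder at most one item, such that every item $i$ is given to at most $C_i$ bidders and $p_i\le v_{ib}$ whenever bidder $b$ receives item $i$. Its profit is the sum, over the bidders who receive an item, of the price of the item received; the goal is to maximize the profit. For every positive integer $t$ and every rational $\alpha>1$ there is an $$\frac{\alpha\,(\alpha^t-1+\alpha^{t-1})}{\alpha^t-1}\text{-approximation}$$ for the Max-Buying-PL-Limited Problem; that is, there is a deterministic algorithm (depending on $t$ and $\alpha$) that runs in time polynomial in the binary length of the instance and, on every instance, returns a feasible solution whose profit $\mathrm{SOL}$ satisfies $$\mathrm{OPT}\le \frac{\alpha\,(\alpha^t-1+\alpha^{t-1})}{\alpha^t-1}\,\mathrm{SOL},$$ where $\mathrm{OPT}$ is the maximum profit of a feasible solution. 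-/

import Mathlib

/-! ## A programming language with a bit-cost measure

The data are finite binary trees whose leaves carry natural numbers written in binary. Programs are
built from elementary operations by sequencing, pairing, branching and while loops. Every step
is charged the total length of the data that it reads and writes. In particular no intermediate value
is longer than the total cost, so that cost in this language and time on a Turing machine are
polynomially related. -/

namespace BitCost

/-- Binary trees whose leaves are natural numbers. -/
inductive Data : Type
  | num (n : ℕ) : Data
  | pair (a b : Data) : Data

namespace Data

/-- The length of the representation of a tree: one symbol for each node, and the binary digits of
each leaf. -/
def size : Data → ℕ
  | num n => Nat.size n + 1
  | pair a b => size a + size b + 1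

/-- Lists as right-nested pairs that end in `num 0`. -/
def ofList : List Data → Data
  | [] => num 0
  | a :: l => pair a (ofList l)

/-- The list `[f 0, …, f (n - 1)]`. -/
def ofFn {n : ℕ} (f : Fin n → Data) : Data :=
  ofList (List.ofFn f)

end Data

/-- Elementary operations. -/
inductive Op : Type
  | id : Op
  | const (n : ℕ) : Op
  | fst : Op
  | snd : Op
  | isPair : Op
  | add : Op
  | sub : Op
  | mul : Op
  | div : Op

/-- The result of an elementary operation; an operation that does not fit its argument returns
`num 0`. Subtraction is truncated, and division rounds down. -/
def Op.apply : Op → Data → Data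
  | .id, x => x
  | .const n, _ => .num n
  | .fst, .pair a _ => a
  | .snd, .pair _ b => b
  | .isPair, .pair _ _ => .num 1
  | .add, .pair (.num a) (.num b) => .num (a + b)
  | .sub, .pair (.num a) (.num b) => .num (a - b)
  | .mul, .pair (.num a) (.num b) => .num (a * b)
  | .div, .pair (.num a) (.num b) => .num (a / b)
  | _, _ => .num 0

/-- Programs; each of them transforms one tree into another. -/
inductive Prog : Type
  /-- apply an elementary operation -/
  | op (o : Op) : Prog
  /-- run `f`, then run `g` on the result -/
  | seq (f g : Prog) : Prog
  /-- run `f` and `g` on the same input and pair the results -/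
  | fork (f g : Prog) : Prog
  /-- run `f` if the test `c` returns something other than `num 0`, and `g` otherwise -/
  | cond (c f g : Prog) : Prog
  /-- as long as the test `c` returns something other than `num 0`, replace the current
  tree by the result of `f` -/
  | loop (c f : Prog) : Prog

/-- `Runs f x y t`: on input `x` the program `f` halts with output `y` at total cost `t`. -/
inductive Runs : Prog → Data → Data → ℕ → Prop
  | op (o : Op) (x : Data) :
      Runs (.op o) x (o.apply x) (x.size + (o.apply x).size)
  | seq {f g : Prog} {x y z : Data} {s t : ℕ} :
      Runs f x y s → Runs g y z t → Runs (.seq f g) x z (s + t)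
  | fork {f g : Prog} {x y z : Data} {s t : ℕ} :
      Runs f x y s → Runs g x z t →
      Runs (.fork f g) x (.pair y z) (s + t + x.size + (Data.pair y z).size)
  | condTrue {c f g : Prog} {x b y : Data} {s t : ℕ} :
      Runs c x b s → b ≠ .num 0 → Runs f x y t → Runs (.cond c f g) x y (s + t + x.size)
  | condFalse {c f g : Prog} {x y : Data} {s t : ℕ} :
      Runs c x (.num 0) s → Runs g x y t → Runs (.cond c f g) x y (s + t + x.size)
  | loopStop {c f : Prog} {x : Data} {s : ℕ} :
      Runs c x (.num 0) s → Runs (.loop c f) x x (s + x.size)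
  | loopStep {c f : Prog} {x b y z : Data} {s t u : ℕ} :
      Runs c x b s → b ≠ .num 0 → Runs f x y t → Runs (.loop c f) y z u →
      Runs (.loop c f) x z (s + t + u + x.size)

/-- Programs are deterministic: output and cost are functions of the input. -/
theorem Runs.deterministic {f : Prog} {x y y' : Data} {t t' : ℕ}
    (h : Runs f x y t) (h' : Runs f x y' t') : y = y' ∧ t = t' := by
  induction h generalizing y' t' with
  | op o x => cases h'; exact ⟨rfl, rfl⟩
  | seq _ _ ih₁ ih₂ =>
    cases h' with
    | seq a b =>
      obtain ⟨rfl, rfl⟩ := ih₁ a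
      obtain ⟨rfl, rfl⟩ := ih₂ b
      exact ⟨rfl, rfl⟩
  | fork _ _ ih₁ ih₂ =>
    cases h' with
    | fork a b =>
      obtain ⟨rfl, rfl⟩ := ih₁ a
      obtain ⟨rfl, rfl⟩ := ih₂ b
      exact ⟨rfl, rfl⟩
  | condTrue _ hb _ ih₁ ih₂ =>
    cases h' with
    | condTrue a _ b =>
      obtain ⟨rfl, rfl⟩ := ih₁ a
      obtain ⟨rfl, rfl⟩ := ih₂ b
      exact ⟨rfl, rfl⟩
    | condFalse a b => exact absurd (ih₁ a).1 hb
  | condFalse _ _ ih₁ ih₂ =>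
    cases h' with
    | condTrue a hb b => exact absurd (ih₁ a).1.symm hb
    | condFalse a b =>
      obtain ⟨_, rfl⟩ := ih₁ a
      obtain ⟨rfl, rfl⟩ := ih₂ b
      exact ⟨rfl, rfl⟩
  | loopStop _ ih₁ =>
    cases h' with
    | loopStop a =>
      obtain ⟨_, rfl⟩ := ih₁ a
      exact ⟨rfl, rfl⟩
    | loopStep a hb _ _ => exact absurd (ih₁ a).1.symm hb
  | loopStep _ hb _ _ ih₁ ih₂ ih₃ =>
    cases h' with
    | loopStop a => exact absurd (ih₁ a).1 hb
    | loopStep a _ b c =>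
      obtain ⟨rfl, rfl⟩ := ih₁ a
      obtain ⟨rfl, rfl⟩ := ih₂ b
      obtain ⟨rfl, rfl⟩ := ih₃ c
      exact ⟨rfl, rfl⟩

/-- The cost of a run is at least the length of its output. -/
theorem Runs.size_le {f : Prog} {x y : Data} {t : ℕ} (h : Runs f x y t) : y.size ≤ t := by
  induction h <;> omega

end BitCost

/-! ## The Max-Buying Problem with Limited Supply and a Price Ladder -/

namespace MaxBuying

open BitCost

/-- An instance: `value i b` is the value of item `i` to bidder `b`, and `copies i` is the number of
copies of item `i`. -/
structure Instance where
  numItems : ℕ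
  numBidders : ℕ
  value : Fin numItems → Fin numBidders → ℕ
  copies : Fin numItems → ℕ

/-- A pricing and an allocation, which gives at most one item to each bidder. -/
structure Solution (J : Instance) where
  price : Fin J.numItems → ℚ
  alloc : Fin J.numBidders → Option (Fin J.numItems)

/-- Feasibility for the variant with limited supply and a price ladder. -/
structure Solution.IsFeasible {J : Instance} (S : Solution J) : Prop where
  price_nonneg : ∀ i, 0 ≤ S.price i
  price_ladder : ∀ i j, i ≤ j → S.price j ≤ S.price i
  item_feasible : ∀ b i, S.alloc b = some i → S.price i ≤ (J.value i b : ℚ)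
  limited_supply : ∀ i, (Finset.univ.filter fun b => S.alloc b = some i).card ≤ J.copies i

/-- The auctioneer's profit. -/
def Solution.profit {J : Instance} (S : Solution J) : ℚ :=
  ∑ b, (S.alloc b).elim 0 S.price

/-- An instance as the list of the numbers of copies, followed by the list that holds, for each bidder,
the list of the bidder's values. -/
def Instance.encode (J : Instance) : Data :=
  .pair (Data.ofFn fun i => .num (J.copies i))
    (Data.ofFn fun b => Data.ofFn fun i => .num (J.value i b))

/-- The item that a bidder receives, as a number: `0` for no item and `i + 1` for the item with
index `i`, the indices starting from `0`. -/
def encodeItem {n : ℕ} : Option (Fin n) → Data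
  | none => .num 0
  | some i => .num ((i : ℕ) + 1)

/-- `d` represents `S`: it consists of the list of the prices, each written as a fraction of two
natural numbers (not necessarily in lowest terms), and the list of the items given to the
bidders. -/
def Solution.IsEncodedBy {J : Instance} (S : Solution J) (d : Data) : Prop :=
  ∃ num den : Fin J.numItems → ℕ,
    (∀ i, den i ≠ 0 ∧ S.price i = (num i : ℚ) / (den i : ℚ)) ∧
    d = .pair (Data.ofFn fun i => .pair (.num (num i)) (.num (den i)))
      (Data.ofFn fun b => encodeItem (S.alloc b))

/-- `f` is a `ρ`-approximation algorithm: there is a polynomial such that, on every instance, `f`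
halts within time bounded by that polynomial in the length of the instance and returns a feasible
solution, and `ρ` times its profit is at least the profit of every feasible solution. -/
def IsApproximation (ρ : ℚ) (f : Prog) : Prop :=
  ∃ P : Polynomial ℕ, ∀ J : Instance, ∃ (d : Data) (time : ℕ) (S : Solution J),
    Runs f J.encode d time ∧ time ≤ P.eval J.encode.size ∧
    S.IsEncodedBy d ∧ S.IsFeasible ∧
    ∀ S' : Solution J, S'.IsFeasible → S'.profit ≤ ρ * S.profit

end MaxBuying

/-! The claimed ratio exceeds `2` by `((α ^ t - 1) * (α - 1) + 1) / (α ^ t - 1) > 0`, so it is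
enough to have a `ρ`-approximation for every rational `ρ > 2` (`MaxBuying.exists_isApproximation`).

Fix a price list and offer the items in index order, hence at decreasing prices, to the bidders one
by one. The greedy sale earns at least half of any allocation at these prices: if the allocation
serves a bidder whom greedy refuses at price `q`, then all copies were sold at `q`, or the bidder
had already bought at a price of at least `q` (`sell_opt`, `le_two_mul_revenue`). It remains to find
good prices. This becomes tractable after a relaxation: a bidder may buy again once the price has
dropped by a factor `G` since the last purchase. Purchases then decay geometrically, so keeping only
the first one costs a factor of at most `G / (G - 1)` (`exec_valid`, `revenue_mul_le_profit`).

In exchange, sales at prices smaller by a factor `G` than all earlier ones do not depend on who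
bought before; they depend only on how many items were already offered (`revenue_append`). Restrict
prices to levels growing by a factor of about `1 + 1 / N`, and go down through the levels in cycles
of length `T`, whose first `g` levels are left unused. These gaps span a factor `G`, so at a gap it
suffices to keep one best list for each length. Between gaps all ways to price further items are
enumerated. For constant `T` the number of lists stays polynomial (`length_sweep_le`), and the sweep
is as good as any price list that respects the gaps (`Follows.step`, `exists_mem_sweep`).

An optimal solution is compared with this by rounding its prices down to levels, losing `(N + 1) /
N`, and by averaging over the `T` positions of the gaps: each level is unused for exactly `g` of
them, which loses `T / (T - g)` (`exists_rounding`). With `N = G = k`, `g = k ^ 2`, `T = k ^ 3` the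
total is `2 * k * (k + 1) / (k - 1) ^ 2`, which tends to `2`.

The running time is handled by a calculus of polynomial-time functions closed under composition,
branching and folds with bounded accumulators, so that the algorithm can be written as ordinary
functions on lists. -/

namespace BitCost

/-! ### Encodings as trees and their lengths. -/

/-- Representation of the elements of a type by trees. -/
class Enc (α : Type) where
  /-- the tree that represents an element -/
  enc : α → Data

open Enc

instance : Enc ℕ := ⟨.num⟩

instance : Enc Bool := ⟨fun b => .num b.toNat⟩

instance {α β : Type} [Enc α] [Enc β] : Enc (α × β) := ⟨fun x => .pair (enc x.1) (enc x.2)⟩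

instance {α : Type} [Enc α] : Enc (List α) := ⟨fun l => Data.ofList (l.map enc)⟩

/-- The length of the representation. -/
def sz {α : Type} [Enc α] (x : α) : ℕ := (enc x).size

section size

variable {α β : Type} [Enc α] [Enc β]

theorem Data.size_pos (d : Data) : 0 < d.size := by
  cases d <;> simp [Data.size]

theorem sz_pos (x : α) : 0 < sz x := Data.size_pos _

@[simp] theorem enc_nil : enc ([] : List α) = .num 0 := rfl

@[simp] theorem enc_cons (a : α) (l : List α) : enc (a :: l) = .pair (enc a) (enc l) := rfl

@[simp] theorem enc_mk (a : α) (b : β) : enc (a, b) = .pair (enc a) (enc b) := rfl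

@[simp] theorem enc_nat (n : ℕ) : enc n = .num n := rfl

theorem sz_nat (n : ℕ) : sz n = Nat.size n + 1 := rfl

@[simp] theorem sz_mk (a : α) (b : β) : sz (a, b) = sz a + sz b + 1 := rfl

theorem sz_prod (x : α × β) : sz x = sz x.1 + sz x.2 + 1 := rfl

@[simp] theorem sz_nil : sz ([] : List α) = 1 := rfl

@[simp] theorem sz_cons (a : α) (l : List α) : sz (a :: l) = sz a + sz l + 1 := rfl

theorem sz_append (l l' : List α) : sz (l ++ l') + 1 = sz l + sz l' := by
  induction l with
  | nil => simp; omega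
  | cons a l ih => simp; omega

theorem sz_reverse (l : List α) : sz l.reverse = sz l := by
  induction l with
  | nil => simp
  | cons a l ih =>
    have := sz_append l.reverse [a]
    rw [List.reverse_cons]
    rw [sz_cons, sz_nil] at this
    rw [sz_cons]
    omega

theorem sz_le_of_mem {a : α} {l : List α} (h : a ∈ l) : sz a < sz l := by
  induction l with
  | nil => simp at h
  | cons b l ih =>
    rcases List.mem_cons.1 h with rfl | h
    · rw [sz_cons]; omega
    · have := ih h; rw [sz_cons]; omega

theorem length_lt_sz (l : List α) : l.length < sz l := by
  induction l with
  | nil => simp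
  | cons b l ih => simp; omega

theorem sz_le_of_forall {l : List α} {M : ℕ} (h : ∀ a ∈ l, sz a ≤ M) :
    sz l ≤ l.length * (M + 1) + 1 := by
  induction l with
  | nil => simp
  | cons b l ih =>
    have h₁ := ih fun a ha => h a (by simp [ha])
    have h₂ := h b (by simp)
    simp [Nat.add_mul]; omega

theorem sz_drop_le (l : List α) (i : ℕ) : sz (l.drop i) ≤ sz l := by
  have h := sz_append (l.take i) (l.drop i)
  have := sz_pos (l.take i)
  rw [List.take_append_drop] at h; omega

theorem sz_tail_le (l : List α) : sz l.tail ≤ sz l := by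
  cases l <;> simp; omega

theorem Nat.size_add_le (a b : ℕ) : Nat.size (a + b) ≤ Nat.size a + Nat.size b := by
  rcases Nat.eq_zero_or_pos a with rfl | ha
  · simp
  rcases Nat.eq_zero_or_pos b with rfl | hb
  · simp
  have h₁ := Nat.lt_size_self a
  have h₂ := Nat.lt_size_self b
  have h₃ : 1 ≤ Nat.size a := Nat.size_pos.2 ha
  have h₄ : 1 ≤ Nat.size b := Nat.size_pos.2 hb
  rw [Nat.size_le, pow_add]
  have h₅ : 2 ≤ 2 ^ Nat.size a := by simpa using Nat.pow_le_pow_right (n := 2) (by simp) h₃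
  have h₆ : 2 ≤ 2 ^ Nat.size b := by simpa using Nat.pow_le_pow_right (n := 2) (by simp) h₄
  nlinarith

theorem sz_nat_add_le (a b : ℕ) : sz (a + b) ≤ sz a + sz b := by
  have := Nat.size_add_le a b
  simp only [sz_nat]; omega

theorem sz_nat_le (a : ℕ) : sz a ≤ a + 1 := by
  have : Nat.size a ≤ a := Nat.size_le.2 Nat.lt_two_pow_self
  simp only [sz_nat]; omega

end size

/-! ### Polynomial bounds -/

/-- `f x` is at most a polynomial in the length of `x`. -/
def PolyBd {α : Type} [Enc α] (f : α → ℕ) : Prop :=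
  ∃ P : Polynomial ℕ, ∀ x, f x ≤ P.eval (sz x)

theorem eval_mono (P : Polynomial ℕ) {a b : ℕ} (h : a ≤ b) : P.eval a ≤ P.eval b := by
  rw [Polynomial.eval_eq_sum_range, Polynomial.eval_eq_sum_range]
  gcongr

namespace PolyBd

variable {α : Type} [Enc α] {f g : α → ℕ}

theorem mono (hg : PolyBd g) (h : ∀ x, f x ≤ g x) : PolyBd f := by
  obtain ⟨P, hP⟩ := hg
  exact ⟨P, fun x => (h x).trans (hP x)⟩

theorem const (c : ℕ) : PolyBd fun _ : α => c := ⟨Polynomial.C c, by simp⟩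

theorem size : PolyBd fun x : α => sz x := ⟨Polynomial.X, by simp⟩

theorem add (hf : PolyBd f) (hg : PolyBd g) : PolyBd fun x => f x + g x := by
  obtain ⟨P, hP⟩ := hf
  obtain ⟨Q, hQ⟩ := hg
  exact ⟨P + Q, fun x => by simpa using Nat.add_le_add (hP x) (hQ x)⟩

theorem mul (hf : PolyBd f) (hg : PolyBd g) : PolyBd fun x => f x * g x := by
  obtain ⟨P, hP⟩ := hf
  obtain ⟨Q, hQ⟩ := hg
  exact ⟨P * Q, fun x => by simpa using Nat.mul_le_mul (hP x) (hQ x)⟩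

theorem pow (hf : PolyBd f) (k : ℕ) : PolyBd fun x => f x ^ k := by
  obtain ⟨P, hP⟩ := hf
  exact ⟨P ^ k, fun x => by simpa using Nat.pow_le_pow_left (hP x) k⟩

theorem eval (hf : PolyBd f) (P : Polynomial ℕ) : PolyBd fun x => P.eval (f x) := by
  obtain ⟨Q, hQ⟩ := hf
  exact ⟨P.comp Q, fun x => by simpa using eval_mono P (hQ x)⟩

end PolyBd

/-! ### Functions computable in polynomial time -/

/-- `f` is computable in polynomial time. -/
@[fun_prop]
def PolyTime {α β : Type} [Enc α] [Enc β] (f : α → β) : Prop :=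
  ∃ (p : Prog) (B : α → ℕ), PolyBd B ∧ ∀ x, ∃ t ≤ B x, Runs p (enc x) (enc (f x)) t

namespace PolyTime

section basic

variable {α β γ : Type} [Enc α] [Enc β] [Enc γ]

/-- Writing the output is charged. This is what makes time bounds compose: the second program runs
on an input of polynomial length. -/
theorem polyBd {f : α → β} (hf : PolyTime f) : PolyBd fun x => sz (f x) := by
  obtain ⟨p, B, hB, h⟩ := hf
  refine hB.mono fun x => ?_
  obtain ⟨t, ht, hr⟩ := h x
  exact hr.size_le.trans ht

theorem of_op (o : Op) {f : α → β} (h : ∀ x, o.apply (enc x) = enc (f x))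
    (hb : PolyBd fun x => sz (f x)) : PolyTime f := by
  refine ⟨.op o, fun x => sz x + sz (f x), PolyBd.size.add hb, fun x => ⟨_, le_rfl, ?_⟩⟩
  have := Runs.op o (enc x)
  rwa [h] at this

@[fun_prop]
theorem id : PolyTime fun x : α => x := of_op .id (fun _ => rfl) PolyBd.size

@[fun_prop]
theorem comp {g : β → γ} {f : α → β} (hg : PolyTime g) (hf : PolyTime f) :
    PolyTime fun x => g (f x) := by
  have hs := hf.polyBd
  obtain ⟨p, B, hB, h⟩ := hf
  obtain ⟨p', B', ⟨P, hP⟩, h'⟩ := hg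
  refine ⟨.seq p p', _, hB.add (hs.eval P), fun x => ?_⟩
  obtain ⟨t, ht, hr⟩ := h x
  obtain ⟨t', ht', hr'⟩ := h' (f x)
  exact ⟨_, Nat.add_le_add ht (ht'.trans (hP _)), hr.seq hr'⟩

@[fun_prop]
theorem mk {f : α → β} {g : α → γ} (hf : PolyTime f) (hg : PolyTime g) :
    PolyTime fun x => (f x, g x) := by
  have hs := hf.polyBd
  have hs' := hg.polyBd
  obtain ⟨p, B, hB, h⟩ := hf
  obtain ⟨p', B', hB', h'⟩ := hg
  refine ⟨.fork p p', _, ((hB.add hB').add PolyBd.size).add ((hs.add hs').add (.const 1)),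
    fun x => ?_⟩
  obtain ⟨t, ht, hr⟩ := h x
  obtain ⟨t', ht', hr'⟩ := h' x
  refine ⟨_, ?_, hr.fork hr'⟩
  exact Nat.add_le_add (Nat.add_le_add_right (Nat.add_le_add ht ht') _) le_rfl

@[fun_prop]
theorem fst {f : α → β × γ} (hf : PolyTime f) : PolyTime fun x => (f x).1 :=
  (of_op .fst (fun _ => rfl) (PolyBd.size.mono fun x => by rw [sz_prod x]; omega) :
    PolyTime fun x : β × γ => x.1).comp hf

@[fun_prop]
theorem snd {f : α → β × γ} (hf : PolyTime f) : PolyTime fun x => (f x).2 :=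
  (of_op .snd (fun _ => rfl) (PolyBd.size.mono fun x => by rw [sz_prod x]; omega) :
    PolyTime fun x : β × γ => x.2).comp hf

/-- The elementary constants are leaves only, so a constant tree is assembled from them by `fork`.
-/
theorem exists_const (d : Data) (α : Type) [Enc α] :
    ∃ (p : Prog) (B : α → ℕ), PolyBd B ∧ ∀ x, ∃ t ≤ B x, Runs p (enc x) d t := by
  induction d with
  | num n =>
    exact ⟨.op (.const n), _, PolyBd.size.add (.const (Data.num n).size),
      fun x => ⟨_, le_rfl, Runs.op (.const n) (enc x)⟩⟩
  | pair a b iha ihb =>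
    obtain ⟨p, B, hB, h⟩ := iha
    obtain ⟨p', B', hB', h'⟩ := ihb
    refine ⟨.fork p p', _, ((hB.add hB').add PolyBd.size).add (.const (Data.pair a b).size),
      fun x => ?_⟩
    obtain ⟨t, ht, hr⟩ := h x
    obtain ⟨t', ht', hr'⟩ := h' x
    refine ⟨_, ?_, hr.fork hr'⟩
    gcongr
    exact le_rfl

@[fun_prop]
theorem const (b : β) : PolyTime fun _ : α => b := exists_const (enc b) α

@[fun_prop]
theorem ite {c : α → Prop} [DecidablePred c] {f g : α → β}
    (hc : PolyTime fun x => decide (c x)) (hf : PolyTime f) (hg : PolyTime g) :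
    PolyTime fun x => if c x then f x else g x := by
  obtain ⟨p, B, hB, h⟩ := hc
  obtain ⟨p₁, B₁, hB₁, h₁⟩ := hf
  obtain ⟨p₂, B₂, hB₂, h₂⟩ := hg
  refine ⟨.cond p p₁ p₂, _, (hB.add (hB₁.add hB₂)).add PolyBd.size, fun x => ?_⟩
  obtain ⟨t, ht, hr⟩ := h x
  obtain ⟨t₁, ht₁, hr₁⟩ := h₁ x
  obtain ⟨t₂, ht₂, hr₂⟩ := h₂ x
  by_cases hx : c x
  · simp only [hx, decide_true, if_true] at hr ⊢
    refine ⟨_, ?_, .condTrue hr (by simp [enc]) hr₁⟩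
    gcongr
    · omega
    · exact le_rfl
  · simp only [hx, decide_false, if_false] at hr ⊢
    refine ⟨_, ?_, .condFalse hr hr₂⟩
    gcongr
    · omega
    · exact le_rfl

/-- Programs see only trees, so types may be changed freely: a Boolean is a number, a nonempty list
is a pair. -/
theorem of_enc_eq {f : α → β} {g : α → γ} (hg : PolyTime g) (h : ∀ x, enc (f x) = enc (g x)) :
    PolyTime f := by
  obtain ⟨p, B, hB, h'⟩ := hg
  exact ⟨p, B, hB, fun x => by rw [h]; exact h' x⟩

end basic

/-! #### Arithmetic and tests -/

section arith

variable {α : Type} [Enc α]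

@[fun_prop]
theorem add {f g : α → ℕ} (hf : PolyTime f) (hg : PolyTime g) : PolyTime fun x => f x + g x :=
  (of_op .add (fun _ => rfl) (PolyBd.size.mono fun x => by
    rw [sz_prod x]; have := sz_nat_add_le x.1 x.2; omega) :
    PolyTime fun x : ℕ × ℕ => x.1 + x.2).comp (hf.mk hg)

theorem sz_nat_mono {a b : ℕ} (h : a ≤ b) : sz a ≤ sz b := by
  have := Nat.size_le_size h
  simp only [sz_nat]; omega

@[fun_prop]
theorem sub {f g : α → ℕ} (hf : PolyTime f) (hg : PolyTime g) : PolyTime fun x => f x - g x :=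
  (of_op .sub (fun _ => rfl) (PolyBd.size.mono fun x => by
    rw [sz_prod x]; have := sz_nat_mono (Nat.sub_le x.1 x.2); omega) :
    PolyTime fun x : ℕ × ℕ => x.1 - x.2).comp (hf.mk hg)

@[fun_prop]
theorem div {f g : α → ℕ} (hf : PolyTime f) (hg : PolyTime g) : PolyTime fun x => f x / g x :=
  (of_op .div (fun _ => rfl) (PolyBd.size.mono fun x => by
    rw [sz_prod x]; have := sz_nat_mono (Nat.div_le_self x.1 x.2); omega) :
    PolyTime fun x : ℕ × ℕ => x.1 / x.2).comp (hf.mk hg)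

@[fun_prop]
theorem mul {f g : α → ℕ} (hf : PolyTime f) (hg : PolyTime g) : PolyTime fun x => f x * g x :=
  (of_op .mul (fun _ => rfl) (PolyBd.size.mono fun x => by
    rw [sz_prod x]
    have : Nat.size (x.1 * x.2) ≤ Nat.size x.1 + Nat.size x.2 := by
      rw [Nat.size_le, pow_add]
      exact Nat.mul_lt_mul'' (Nat.lt_size_self _) (Nat.lt_size_self _)
    simp only [sz_nat]; omega) :
    PolyTime fun x : ℕ × ℕ => x.1 * x.2).comp (hf.mk hg)

@[fun_prop]
theorem toNat {f : α → Bool} (hf : PolyTime f) : PolyTime fun x => (f x).toNat :=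
  hf.of_enc_eq fun _ => rfl

@[fun_prop]
theorem decide_le {f g : α → ℕ} [DecidablePred fun x => f x ≤ g x] (hf : PolyTime f)
    (hg : PolyTime g) : PolyTime fun x => decide (f x ≤ g x) := by
  -- With truncated subtraction this number is `1` if `f x ≤ g x` and `0` otherwise.
  have : PolyTime fun x => 1 - (f x - g x) := by fun_prop
  refine this.of_enc_eq fun x => ?_
  by_cases h : f x ≤ g x
  · simp [h, enc]
  · have : 1 - (f x - g x) = 0 := by omega
    simp [h, enc, this]

@[fun_prop]
theorem decide_lt {f g : α → ℕ} [DecidablePred fun x => f x < g x] (hf : PolyTime f)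
    (hg : PolyTime g) : PolyTime fun x => decide (f x < g x) := by
  have : PolyTime fun x => decide (f x + 1 ≤ g x) := by fun_prop
  exact this.of_enc_eq fun x => by simp only [Nat.lt_iff_add_one_le]

@[fun_prop]
theorem decide_and {p q : α → Prop} [DecidablePred p] [DecidablePred q]
    [DecidablePred fun x => p x ∧ q x] (hp : PolyTime fun x => decide (p x))
    (hq : PolyTime fun x => decide (q x)) : PolyTime fun x => decide (p x ∧ q x) := by
  have : PolyTime fun x => (decide (p x)).toNat * (decide (q x)).toNat := by fun_prop
  refine this.of_enc_eq fun x => ?_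
  by_cases h : p x <;> by_cases h' : q x <;> simp [h, h', enc]

@[fun_prop]
theorem decide_or {p q : α → Prop} [DecidablePred p] [DecidablePred q]
    [DecidablePred fun x => p x ∨ q x] (hp : PolyTime fun x => decide (p x))
    (hq : PolyTime fun x => decide (q x)) : PolyTime fun x => decide (p x ∨ q x) := by
  have : PolyTime fun x => 1 - (1 - (decide (p x)).toNat) * (1 - (decide (q x)).toNat) := by
    fun_prop
  refine this.of_enc_eq fun x => ?_
  by_cases h : p x <;> by_cases h' : q x <;> simp [h, h', enc]

@[fun_prop]
theorem decide_eq {f g : α → ℕ} [DecidablePred fun x => f x = g x] (hf : PolyTime f)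
    (hg : PolyTime g) : PolyTime fun x => decide (f x = g x) := by
  have : PolyTime fun x => decide (f x ≤ g x ∧ g x ≤ f x) := by fun_prop
  exact this.of_enc_eq fun x => by simp only [← le_antisymm_iff]

end arith

/-! #### Loops -/

theorem runs_loop {c f : Prog} {st : ℕ → Data} {n Tc Tf M : ℕ}
    (hc : ∀ i < n, ∃ b, ∃ t ≤ Tc, Runs c (st i) b t ∧ b ≠ .num 0)
    (hend : ∃ t ≤ Tc, Runs c (st n) (.num 0) t)
    (hf : ∀ i < n, ∃ t ≤ Tf, Runs f (st i) (st (i + 1)) t)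
    (hM : ∀ i ≤ n, (st i).size ≤ M) :
    ∃ t ≤ (n + 1) * (Tc + Tf + M), Runs (.loop c f) (st 0) (st n) t := by
  induction n generalizing st with
  | zero =>
    obtain ⟨t, ht, hr⟩ := hend
    have := hM 0 le_rfl
    exact ⟨_, by omega, .loopStop hr⟩
  | succ n ih =>
    obtain ⟨b, t, ht, hr, hb⟩ := hc 0 (by omega)
    obtain ⟨t', ht', hr'⟩ := hf 0 (by omega)
    obtain ⟨t'', ht'', hr''⟩ := ih (st := fun i => st (i + 1)) (fun i hi => hc _ (by omega)) hend
      (fun i hi => hf _ (by omega)) (fun i hi => hM _ (by omega))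
    have := hM 0 (by omega)
    refine ⟨_, ?_, .loopStep hr hb hr' hr''⟩
    rw [Nat.add_mul (n + 1)]
    omega

/-- One step of `List.foldl`, on triples of a parameter, an accumulator and a list. -/
def foldlStep {α β σ : Type} (step : α → σ → β → σ) (z : α × σ × List β) : α × σ × List β :=
  match z.2.2 with
  | [] => z
  | b :: l => (z.1, step z.1 z.2.1 b, l)

theorem foldlStep_iterate {α β σ : Type} (step : α → σ → β → σ) (x : α) (l₁ l₂ : List β) (s : σ) :
    (foldlStep step)^[l₁.length] (x, s, l₁ ++ l₂) = (x, l₁.foldl (step x) s, l₂) := by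
  induction l₁ generalizing s with
  | nil => rfl
  | cons b l ih =>
    rw [List.length_cons, Function.iterate_succ_apply]
    exact ih _

section loop

variable {α β γ σ : Type} [Enc α] [Enc β] [Enc γ] [Enc σ]

/-- The bound `B` in terms of the original input is essential: a polynomial-time step may double the
length of the state, and iterating it would then be exponential. -/
theorem iterate {init : α → σ} {c : σ → Bool} {f : σ → σ} {n : α → ℕ} {B : α → ℕ}
    (hinit : PolyTime init) (hc : PolyTime c) (hf : PolyTime f) (hn : PolyBd n)
    (hB : PolyBd B) (h₁ : ∀ x, ∀ i < n x, c (f^[i] (init x)) = true)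
    (h₂ : ∀ x, c (f^[n x] (init x)) = false)
    (hs : ∀ x, ∀ i ≤ n x, sz (f^[i] (init x)) ≤ B x) :
    PolyTime fun x => f^[n x] (init x) := by
  obtain ⟨p, B₀, hB₀, h⟩ := hinit
  obtain ⟨pc, Bc, ⟨Pc, hPc⟩, hrc⟩ := hc
  obtain ⟨pf, Bf, ⟨Pf, hPf⟩, hrf⟩ := hf
  refine ⟨.seq p (.loop pc pf), _, hB₀.add ((hn.add (.const 1)).mul
    (((hB.eval Pc).add (hB.eval Pf)).add hB)), fun x => ?_⟩
  obtain ⟨t₀, ht₀, hr₀⟩ := h x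
  have key := runs_loop (c := pc) (f := pf) (st := fun i => enc (f^[i] (init x))) (n := n x)
    (Tc := Pc.eval (B x)) (Tf := Pf.eval (B x)) (M := B x) ?_ ?_ ?_ (hs x)
  · obtain ⟨t, ht, hr⟩ := key
    exact ⟨_, Nat.add_le_add ht₀ ht, hr₀.seq hr⟩
  · intro i hi
    obtain ⟨t, ht, hr⟩ := hrc (f^[i] (init x))
    exact ⟨_, t, ht.trans ((hPc _).trans (eval_mono _ (hs x i hi.le))), hr,
      by simp [h₁ x i hi, enc]⟩
  · obtain ⟨t, ht, hr⟩ := hrc (f^[n x] (init x))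
    refine ⟨t, ht.trans ((hPc _).trans (eval_mono _ (hs x _ le_rfl))), ?_⟩
    rw [h₂] at hr
    exact hr
  · intro i hi
    obtain ⟨t, ht, hr⟩ := hrf (f^[i] (init x))
    refine ⟨t, ht.trans ((hPf _).trans (eval_mono _ (hs x i hi.le))), ?_⟩
    rw [← Function.iterate_succ_apply' f] at hr
    exact hr

@[fun_prop]
theorem cons {f : α → β} {g : α → List β} (hf : PolyTime f) (hg : PolyTime g) :
    PolyTime fun x => f x :: g x :=
  (hf.mk hg).of_enc_eq fun _ => rfl

@[fun_prop]
theorem tail {g : α → List β} (hg : PolyTime g) : PolyTime fun x => (g x).tail :=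
  (of_op .snd (fun l => by cases l <;> rfl) (PolyBd.size.mono sz_tail_le) :
    PolyTime fun x : List β => x.tail).comp hg

theorem decide_ne_nil {g : α → List β} (hg : PolyTime g) :
    PolyTime fun x => decide (g x ≠ []) :=
  (of_op .isPair (fun l => by cases l <;> simp <;> rfl) ((PolyBd.const 2).mono fun l => by
    cases l <;> simp [sz, enc, Data.size]) :
    PolyTime fun x : List β => decide (x ≠ [])).comp hg

theorem list_cases {g : α → List β} {f : α → γ} {h : α → β → List β → γ} (hg : PolyTime g)
    (hf : PolyTime f) (hh : PolyTime fun z : α × β × List β => h z.1 z.2.1 z.2.2) :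
    PolyTime fun x => match g x with
      | [] => f x
      | b :: l => h x b l := by
  have hp : PolyTime fun x => (x, g x) := by fun_prop
  have hps := hp.polyBd
  obtain ⟨p, B, hB, hr⟩ := hg.decide_ne_nil
  obtain ⟨p₁, B₁, hB₁, hr₁⟩ := hf
  obtain ⟨p₂, B₂, hB₂, hr₂⟩ := hp
  obtain ⟨p₃, B₃, ⟨P, hP⟩, hr₃⟩ := hh
  refine ⟨.cond p (.seq p₂ p₃) p₁, _, (hB.add (hB₁.add (hB₂.add (hps.eval P)))).add PolyBd.size,
    fun x => ?_⟩
  obtain ⟨t, ht, hr⟩ := hr x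
  obtain ⟨t₁, ht₁, hr₁⟩ := hr₁ x
  obtain ⟨t₂, ht₂, hr₂⟩ := hr₂ x
  cases hx : g x with
  | nil =>
    simp only [hx] at hr ⊢
    refine ⟨_, ?_, .condFalse hr hr₁⟩
    gcongr
    · omega
    · exact le_rfl
  | cons b l =>
    obtain ⟨t₃, ht₃, hr₃⟩ := hr₃ (x, b, l)
    have h₃ := hP (x, b, l)
    simp only [hx] at hr hr₂ ⊢
    refine ⟨_, ?_, .condTrue hr (by simp [enc]) (.seq hr₂ hr₃)⟩
    refine Nat.add_le_add ?_ le_rfl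
    -- A list cell and a pair are the same tree, so no work is needed to split the list.
    have : P.eval (sz (x, b, l)) = P.eval (sz (x, b :: l)) := rfl
    omega

@[fun_prop]
theorem headD {g : α → List β} {d : α → β} (hg : PolyTime g) (hd : PolyTime d) :
    PolyTime fun x => (g x).headD (d x) :=
  (hg.list_cases hd (h := fun _ b _ => b) (by fun_prop)).of_enc_eq fun x => by
    cases g x <;> rfl

/-- The loop carries the parameter, the accumulator and the remaining list; the prefixes of the list
are exactly the parts already consumed when the accumulator has to be bounded. -/
theorem foldl {init : α → σ} {l : α → List β} {step : α → σ → β → σ} {B : α → ℕ}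
    (hinit : PolyTime init) (hl : PolyTime l)
    (hstep : PolyTime fun z : α × σ × β => step z.1 z.2.1 z.2.2) (hB : PolyBd B)
    (hs : ∀ x l₁, l₁ <+: l x → sz (l₁.foldl (step x) (init x)) ≤ B x) :
    PolyTime fun x => (l x).foldl (step x) (init x) := by
  have hit : ∀ x, ∀ i ≤ (l x).length, (foldlStep step)^[i] (x, init x, l x) =
      (x, ((l x).take i).foldl (step x) (init x), (l x).drop i) := fun x i hi => by
    have := foldlStep_iterate step x ((l x).take i) ((l x).drop i) (init x)
    rwa [List.take_append_drop, List.length_take_of_le hi] at this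
  have key := iterate (init := fun x => (x, init x, l x))
    (c := fun z : α × σ × List β => decide (z.2.2 ≠ [])) (f := foldlStep step)
    (n := fun x => (l x).length) (by fun_prop) (decide_ne_nil (by fun_prop))
    (list_cases (g := fun z : α × σ × List β => z.2.2) (f := fun z => z) (by fun_prop)
      (by fun_prop) (h := fun z b l => (z.1, step z.1 z.2.1 b, l)) ?_)
    (hl.polyBd.mono fun x => (length_lt_sz (l x)).le)
    ((PolyBd.size.add (hB.add (hl.polyBd.add (.const 1)))).add (.const 1)) ?_ ?_ ?_
  · refine key.snd.fst.of_enc_eq fun x => ?_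
    rw [hit x _ le_rfl, List.take_length]
  · have := hstep.comp (f := fun z : (α × σ × List β) × β × List β => (z.1.1, z.1.2.1, z.2.1))
      (by fun_prop)
    fun_prop
  · intro x i hi
    rw [hit x i hi.le]
    simpa using hi
  · intro x
    rw [hit x _ le_rfl]
    simp
  · intro x i hi
    rw [hit x i hi]
    have h₁ := hs x _ (List.take_prefix i (l x))
    have h₂ := sz_drop_le (l x) i
    simp only [sz_mk]
    omega

/-- If every step adds only a bounded amount to the accumulator, folding takes polynomial time. -/
theorem foldl_of_growth {init : α → σ} {l : α → List β} {step : α → σ → β → σ} {B : α → ℕ}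
    (hinit : PolyTime init) (hl : PolyTime l)
    (hstep : PolyTime fun z : α × σ × β => step z.1 z.2.1 z.2.2) (hB : PolyBd B)
    (hs : ∀ x, ∀ b ∈ l x, ∀ s, sz (step x s b) ≤ sz s + B x) :
    PolyTime fun x => (l x).foldl (step x) (init x) := by
  refine foldl hinit hl hstep (hinit.polyBd.add (hl.polyBd.mul hB)) fun x l₁ h₁ => ?_
  have h₂ : sz (l₁.foldl (step x) (init x)) ≤ sz (init x) + l₁.length * B x := by
    have h₃ : ∀ b ∈ l₁, b ∈ l x := fun b hb => h₁.subset hb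
    clear h₁
    generalize init x = s₀
    induction l₁ generalizing s₀ with
    | nil => simp
    | cons b l ih =>
      have h₄ := ih (fun b hb => h₃ b (by simp [hb])) (step x s₀ b)
      have h₅ := hs x b (h₃ b (by simp)) s₀
      rw [List.foldl_cons, List.length_cons, Nat.add_mul]
      omega
  refine h₂.trans ?_
  gcongr
  exact h₁.length_le.trans (length_lt_sz (l x)).le

@[fun_prop]
theorem reverse {g : α → List β} (hg : PolyTime g) : PolyTime fun x => (g x).reverse := by
  have : PolyTime fun x => (g x).foldl (fun s b => b :: s) [] := by
    refine foldl_of_growth (step := fun _ s b => b :: s) (by fun_prop) hg (by fun_prop)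
      (hg.polyBd.add (.const 1)) fun x b hb s => ?_
    have := sz_le_of_mem hb
    rw [sz_cons]; omega
  simpa using this

@[fun_prop]
theorem append {f g : α → List β} (hf : PolyTime f) (hg : PolyTime g) :
    PolyTime fun x => f x ++ g x := by
  have : PolyTime fun x => (f x).reverse.foldl (fun s b => b :: s) (g x) := by
    refine foldl_of_growth (step := fun _ s b => b :: s) (by fun_prop) (by fun_prop) (by fun_prop)
      (hf.polyBd.add (.const 1)) fun x b hb s => ?_
    have := sz_le_of_mem (List.mem_reverse.1 hb)
    rw [sz_cons]; omega
  simpa using this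

@[fun_prop]
theorem length {g : α → List β} (hg : PolyTime g) : PolyTime fun x => (g x).length := by
  have h : ∀ l : List β, ∀ k, l.foldl (fun s _ => s + 1) k = k + l.length := fun l => by
    induction l with
    | nil => simp
    | cons b l ih => intro k; rw [List.foldl_cons, ih, List.length_cons]; omega
  have : PolyTime fun x => (g x).foldl (fun s _ => s + 1) 0 := by
    refine foldl_of_growth (step := fun _ s _ => s + 1) (by fun_prop) (by fun_prop) (by fun_prop)
      (.const 2) fun x b hb s => ?_
    have := sz_nat_add_le s 1
    exact this
  simpa [h] using this

theorem flatMap {f : α → β → List γ} {g : α → List β}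
    (hf : PolyTime fun z : α × β => f z.1 z.2) (hg : PolyTime g) :
    PolyTime fun x => (g x).flatMap (f x) := by
  have h : ∀ x, ∀ l : List β, ∀ k, l.foldl (fun s b => s ++ f x b) k = k ++ l.flatMap (f x) :=
    fun x l => by
    induction l with
    | nil => simp
    | cons b l ih => intro k; rw [List.foldl_cons, ih, List.flatMap_cons, List.append_assoc]
  have : PolyTime fun x => (g x).foldl (fun s b => s ++ f x b) [] := by
    obtain ⟨P, hP⟩ := hf.polyBd
    refine foldl_of_growth (step := fun x s b => s ++ f x b) (by fun_prop) (by fun_prop) ?_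
      ((PolyBd.size.add hg.polyBd).eval P) fun x b hb s => ?_
    · have := hf.comp (f := fun z : α × List γ × β => (z.1, z.2.2)) (by fun_prop)
      fun_prop
    · have h₁ := sz_append s (f x b)
      have h₂ := hP (x, b)
      have h₃ : P.eval (sz (x, b)) ≤ P.eval (sz x + sz (g x)) :=
        eval_mono _ (by have := sz_le_of_mem hb; rw [sz_mk]; omega)
      simp only at h₂
      omega
  simpa [h] using this

theorem map {f : α → β → γ} {g : α → List β}
    (hf : PolyTime fun z : α × β => f z.1 z.2) (hg : PolyTime g) :
    PolyTime fun x => (g x).map (f x) := by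
  have := flatMap (f := fun x b => [f x b]) (g := g) (by fun_prop) hg
  simpa [← List.map_eq_flatMap] using this

theorem filter {p : α → β → Bool} {g : α → List β}
    (hp : PolyTime fun z : α × β => p z.1 z.2) (hg : PolyTime g) :
    PolyTime fun x => (g x).filter (p x) := by
  have := flatMap (f := fun x b => if p x b then [b] else []) (g := g) ?_ hg
  · refine this.of_enc_eq fun x => congrArg _ ?_
    induction g x with
    | nil => rfl
    | cons b l ih => rw [List.filter_cons, List.flatMap_cons, ← ih]; split <;> rfl
  · refine ite ?_ (by fun_prop) (by fun_prop)
    simpa using hp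

end loop

end PolyTime

end BitCost

/-! ### Sums, ranges and indexing in polynomial time. -/

namespace BitCost

namespace PolyTime

variable {α β : Type} [Enc α] [Enc β]

@[fun_prop]
theorem sum {g : α → List ℕ} (hg : PolyTime g) : PolyTime fun x => (g x).sum := by
  have h : ∀ l : List ℕ, ∀ k, l.foldl (fun s b => s + b) k = k + l.sum := fun l => by
    induction l with
    | nil => simp
    | cons b l ih => intro k; rw [List.foldl_cons, ih, List.sum_cons]; omega
  have : PolyTime fun x => (g x).foldl (fun s b => s + b) 0 := by
    refine foldl_of_growth (step := fun _ s b => s + b) (by fun_prop) (by fun_prop) (by fun_prop)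
      hg.polyBd fun x b hb s => ?_
    have := sz_nat_add_le s b
    have := sz_le_of_mem hb
    omega
  simpa [h] using this

-- A number in binary can be exponential in its length, so a range is polynomial only up to a bound
-- given in unary, here by a list.
@[fun_prop]
theorem range_length {g : α → List β} (hg : PolyTime g) :
    PolyTime fun x => List.range (g x).length := by
  have h : ∀ l : List β, l.foldl (fun (s : ℕ × List ℕ) _ => (s.1 + 1, s.1 :: s.2)) (0, []) =
      (l.length, (List.range l.length).reverse) := fun l => by
    induction l using List.reverseRecOn with
    | nil => simp
    | append_singleton l b ih => simp [ih, List.range_succ]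
  have : PolyTime fun x => (g x).foldl (fun (s : ℕ × List ℕ) _ => (s.1 + 1, s.1 :: s.2)) (0, []) := by
    have hb := hg.polyBd
    refine foldl (step := fun _ (s : ℕ × List ℕ) _ => (s.1 + 1, s.1 :: s.2)) (by fun_prop) hg
      (by fun_prop) ((hb.add (hb.mul (hb.add (.const 1)))).add (.const 3)) fun x l h₁ => ?_
    rw [h, sz_mk, sz_reverse]
    have h₂ : l.length ≤ sz (g x) := h₁.length_le.trans (length_lt_sz _).le
    have h₃ : sz (List.range l.length) ≤ l.length * (sz (g x) + 1) + 1 := by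
      have := sz_le_of_forall (l := List.range l.length) (M := sz (g x)) fun a ha => by
        have := sz_nat_le a
        have := List.mem_range.1 ha
        omega
      simpa using this
    have h₄ := sz_nat_le l.length
    have h₅ : l.length * (sz (g x) + 1) ≤ sz (g x) * (sz (g x) + 1) := by gcongr
    omega
  have := this.snd.reverse
  simpa [h] using this

@[fun_prop]
theorem getD {g : α → List β} {i : α → ℕ} {d : α → β} (hg : PolyTime g) (hi : PolyTime i)
    (hd : PolyTime d) : PolyTime fun x => (g x).getD (i x) (d x) := by
  have h : ∀ (d : β) (i : ℕ) (l : List β), l.foldl (fun (s : ℕ × β) b =>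
      (s.1 + 1, if s.1 = i then b else s.2)) (0, d) = (l.length, l.getD i d) := fun d i l => by
    induction l using List.reverseRecOn with
    | nil => simp
    | append_singleton l b ih =>
      rw [List.foldl_concat, ih]
      simp only [List.length_append, List.length_singleton, Prod.mk.injEq, true_and]
      rcases lt_trichotomy l.length i with h | rfl | h
      · rw [if_neg h.ne, List.getD_eq_default _ _ h.le, List.getD_eq_default]
        simp; omega
      · simp
      · rw [if_neg h.ne', List.getD_append _ _ _ _ h]
  have : PolyTime fun x => (g x).foldl (fun (s : ℕ × β) b =>
      (s.1 + 1, if s.1 = i x then b else s.2)) (0, d x) := by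
    have hb := hg.polyBd
    refine foldl (step := fun x (s : ℕ × β) b => (s.1 + 1, if s.1 = i x then b else s.2))
      (by fun_prop) hg (by fun_prop) ((hb.add (hb.add hd.polyBd)).add (.const 2)) fun x l h₁ => ?_
    rw [h, sz_mk]
    have h₂ : l.length ≤ sz (g x) := h₁.length_le.trans (length_lt_sz _).le
    have h₃ := sz_nat_le l.length
    have h₄ : sz (l.getD (i x) (d x)) ≤ sz (g x) + sz (d x) := by
      by_cases hl : i x < l.length
      · rw [List.getD_eq_getElem _ _ hl]
        have := sz_le_of_mem (h₁.subset (List.getElem_mem hl))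
        omega
      · rw [List.getD_eq_default _ _ (by omega)]
        omega
    omega
  have := this.snd
  simpa [h] using this

end PolyTime

end BitCost

namespace MaxBuying

open BitCost

/-! ### The algorithm -/

/-- The rounded prices: consecutive ones differ by a factor of about `1 + 1 / N`. -/
def level (N : ℕ) : ℕ → ℕ
  | 0 => 0
  | k + 1 => level N k + level N k / N + 1

/-- The first `k` rounded prices in decreasing order. -/
def levels (N : ℕ) : ℕ → List ℕ
  | 0 => []
  | k + 1 => level N k :: levels N k

/-- The numbers of copies and, for each bidder, the list of values. -/
abbrev Input := List ℕ × List (List ℕ)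

/-- The state of a bidder: values for the items to come, the last price paid, the first item bought
(`0` for none, `i + 1` for the item with index `i`), the total amount spent, the first price paid. -/
abbrev Bidder := List ℕ × ℕ × ℕ × ℕ × ℕ

namespace Bidder

/-- The last price paid. -/
def last (s : Bidder) : ℕ := s.2.1
/-- The first item bought. -/
def item (s : Bidder) : ℕ := s.2.2.1
/-- The total amount spent. -/
def spent (s : Bidder) : ℕ := s.2.2.2.1
/-- The first price paid. -/
def first (s : Bidder) : ℕ := s.2.2.2.2

/-- A bidder can afford the next item at price `q`, and has not bought anything yet or only at prices
of at least `G * q`. -/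
def Willing (G q : ℕ) (s : Bidder) : Prop := q ≤ s.1.headD 0 ∧ (s.item = 0 ∨ G * q ≤ s.last)

instance (G q : ℕ) : DecidablePred (Willing G q) := fun _ => inferInstanceAs (Decidable (_ ∧ _))

/-- The bidder buys the next item, with number `k`, at price `q`. -/
def buy (k q : ℕ) (s : Bidder) : Bidder :=
  (s.1.tail, q, if s.item = 0 then k else s.item, s.spent + q, if s.item = 0 then q else s.first)

/-- The bidder does not buy the next item. -/
def pass (s : Bidder) : Bidder := (s.1.tail, s.2)

end Bidder

/-- Item number `k` is offered to the bidders one by one at price `q`, as long as copies remain. -/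
def sell (G k q : ℕ) : ℕ → List Bidder → List Bidder
  | _, [] => []
  | C, s :: l =>
    if 0 < C ∧ s.Willing G q then s.buy k q :: sell G k q (C - 1) l else s.pass :: sell G k q C l

/-- Offering the next item at price `q`; a state consists of the number of items offered so far, the
numbers of copies of the items to come, and the states of the bidders. -/
def offer (G : ℕ) (st : ℕ × List ℕ × List Bidder) (q : ℕ) : ℕ × List ℕ × List Bidder :=
  (st.1 + 1, st.2.1.tail, sell G (st.1 + 1) q (st.2.1.headD 0) st.2.2)

/-- The state at the start. -/
def initial (X : Input) : ℕ × List ℕ × List Bidder :=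
  (0, X.1, X.2.map fun v => (v, 0, 0, 0, 0))

/-- The state after the items have been offered at the prices in `r`, the last item coming first in
this list. -/
def exec (G : ℕ) (X : Input) (r : List ℕ) : ℕ × List ℕ × List Bidder :=
  r.foldr (fun q st => offer G st q) (initial X)

/-- The total revenue. -/
def revenue (G : ℕ) (X : Input) (r : List ℕ) : ℕ := ((exec G X r).2.2.map Bidder.spent).sum

/-- A list of prices with the largest revenue. -/
def best (G : ℕ) (X : Input) (l : List (List ℕ)) : List ℕ :=
  l.foldl (fun a r => if revenue G X a ≤ revenue G X r then r else a) []

/-- Keep one best price list for each length. -/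
def prune (G : ℕ) (X : Input) (l : List (List ℕ)) : List (List ℕ) :=
  (List.range (X.1.length + 1)).map fun e => best G X (l.filter fun r => decide (r.length = e))

/-- Price at most `n` further items at `q`. -/
def extend (q n : ℕ) (r : List ℕ) : List (List ℕ) :=
  (List.range (n + 1)).reverse.map fun e => List.replicate e q ++ r

/-- Price further items at `q`, in all possible ways. -/
def branch (X : Input) (q : ℕ) (l : List (List ℕ)) : List (List ℕ) :=
  l.flatMap (extend q X.1.length)

/-- The next phase in a cycle of length `T`. -/
def nextPhase (T c : ℕ) : ℕ := if c + 1 = T then 0 else c + 1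

/-- The treatment of one price level: in the first `g` phases of a cycle no item gets this price. -/
def sweepStep (G T g : ℕ) (X : Input) (s : ℕ × List (List ℕ)) (q : ℕ) : ℕ × List (List ℕ) :=
  (nextPhase T s.1, if s.1 < g then prune G X s.2 else branch X q s.2)

/-- The price lists found by going through the levels in decreasing order, starting in phase `c`. -/
def sweep (G T g : ℕ) (X : Input) (c : ℕ) (L : List ℕ) : ℕ × List (List ℕ) :=
  L.foldl (sweepStep G T g X) (c, [[]])

/-- The price lists found for the first `k` initial phases. -/
def candidates (G T g : ℕ) (X : Input) (L : List ℕ) : ℕ → List (List ℕ)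
  | 0 => []
  | k + 1 => (sweep G T g X k L).2 ++ candidates G T g X L k

/-- The sum of all values. -/
def total (X : Input) : ℕ := (X.2.map List.sum).sum

theorem exists_lt_level (N V : ℕ) : ∃ k, V < level N k := by
  have h : ∀ k, k ≤ level N k := fun k => by
    induction k with
    | zero => simp
    | succ k ih => exact Nat.succ_le_succ (ih.trans (Nat.le_add_right _ _))
  exact ⟨V + 1, h _⟩

/-- The first level above `V`. -/
def topLevel (N V : ℕ) : ℕ := Nat.find (exists_lt_level N V)

/-- The price list that the algorithm selects. -/
def select (N G T g : ℕ) (X : Input) : List ℕ :=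
  best G X (candidates G T g X (levels N (topLevel N (total X) + 1)) T)

/-- Prices, as fractions, and numbers of the items that the bidders receive. -/
def output (G : ℕ) (X : Input) (r : List ℕ) : List (ℕ × ℕ) × List ℕ :=
  ((List.range X.1.length).map fun i => (r.reverse.getD i 0, 1), (exec G X r).2.2.map Bidder.item)

/-! ### Running time -/

section

variable {α : Type} [Enc α]

@[fun_prop]
theorem Bidder.polyTime_item {f : α → Bidder} (hf : PolyTime f) :
    PolyTime fun x => (f x).item := by
  unfold Bidder.item; fun_prop

@[fun_prop]
theorem Bidder.polyTime_spent {f : α → Bidder} (hf : PolyTime f) :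
    PolyTime fun x => (f x).spent := by
  unfold Bidder.spent; fun_prop

@[fun_prop]
theorem Bidder.polyTime_last {f : α → Bidder} (hf : PolyTime f) :
    PolyTime fun x => (f x).last := by
  unfold Bidder.last; fun_prop

@[fun_prop]
theorem Bidder.polyTime_first {f : α → Bidder} (hf : PolyTime f) :
    PolyTime fun x => (f x).first := by
  unfold Bidder.first; fun_prop

@[fun_prop]
theorem Bidder.polyTime_willing (G : ℕ) {q : α → ℕ} {f : α → Bidder}
    [DecidablePred fun x => (f x).Willing G (q x)] (hq : PolyTime q) (hf : PolyTime f) :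
    PolyTime fun x => decide ((f x).Willing G (q x)) := by
  have : PolyTime fun x =>
      decide (q x ≤ (f x).1.headD 0 ∧ ((f x).item = 0 ∨ G * q x ≤ (f x).last)) := by fun_prop
  exact this.of_enc_eq fun x => congrArg _ (decide_eq_decide.2 Iff.rfl)

@[fun_prop]
theorem Bidder.polyTime_buy {k q : α → ℕ} {f : α → Bidder} (hk : PolyTime k) (hq : PolyTime q)
    (hf : PolyTime f) : PolyTime fun x => (f x).buy (k x) (q x) := by
  unfold Bidder.buy; fun_prop

@[fun_prop]
theorem Bidder.polyTime_pass {f : α → Bidder} (hf : PolyTime f) : PolyTime fun x => (f x).pass := by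
  unfold Bidder.pass; fun_prop

end

/-- Tail-recursive form of the sale, for the fold rule; it builds the list of bidders in reverse. -/
theorem sell_eq_foldl (G k q : ℕ) (l : List Bidder) (C : ℕ) (o : List Bidder) :
    (l.foldl (fun (a : ℕ × List Bidder) s =>
      if 0 < a.1 ∧ s.Willing G q then (a.1 - 1, s.buy k q :: a.2) else (a.1, s.pass :: a.2))
      (C, o)).2 = (sell G k q C l).reverse ++ o := by
  induction l generalizing C o with
  | nil => simp [sell]
  | cons s l ih =>
    rw [List.foldl_cons, sell]
    split <;> simp [ih]

theorem Bidder.sz_buy_le (k q : ℕ) (s : Bidder) : sz (s.buy k q) ≤ sz s + (3 * sz q + sz k) := by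
  obtain ⟨v, a, b, c, d⟩ := s
  have h₁ := sz_tail_le v
  have h₂ := sz_nat_add_le c q
  by_cases h : b = 0 <;>
    simp only [Bidder.buy, Bidder.item, Bidder.spent, Bidder.first, sz_mk, h, if_true, if_false] <;>
    omega

theorem Bidder.sz_pass_le (s : Bidder) : sz s.pass ≤ sz s := by
  obtain ⟨v, s⟩ := s
  have h₁ := sz_tail_le v
  simp only [Bidder.pass, sz_mk]
  omega

theorem sz_sell_le (G k q : ℕ) (l : List Bidder) (C : ℕ) :
    sz (sell G k q C l) ≤ sz l + l.length * (3 * sz q + sz k) := by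
  induction l generalizing C with
  | nil => simp [sell]
  | cons s l ih =>
    have h₁ := s.sz_buy_le k q
    have h₂ := s.sz_pass_le
    have h₃ := ih C
    have h₄ := ih (C - 1)
    rw [sell]
    split <;> simp only [sz_cons, List.length_cons, Nat.add_mul, one_mul] at * <;> omega

@[simp]
theorem length_sell (G k q : ℕ) (l : List Bidder) (C : ℕ) :
    (sell G k q C l).length = l.length := by
  induction l generalizing C with
  | nil => simp [sell]
  | cons s l ih => rw [sell]; split <;> simp [ih]

@[simp]
theorem exec_nil (G : ℕ) (X : Input) : exec G X [] = initial X := rfl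

@[simp]
theorem exec_cons (G : ℕ) (X : Input) (q : ℕ) (r : List ℕ) :
    exec G X (q :: r) = offer G (exec G X r) q := rfl

@[simp]
theorem exec_fst (G : ℕ) (X : Input) (r : List ℕ) : (exec G X r).1 = r.length := by
  induction r with
  | nil => rfl
  | cons q r ih => simp [offer, ih]

@[simp]
theorem length_exec (G : ℕ) (X : Input) (r : List ℕ) :
    (exec G X r).2.2.length = X.2.length := by
  induction r with
  | nil => simp [initial]
  | cons q r ih => simp [offer, ih]

theorem exec_copies (G : ℕ) (X : Input) (r : List ℕ) :
    (exec G X r).2.1 = X.1.drop r.length := by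
  induction r with
  | nil => simp [initial]
  | cons q r ih => simp [offer, ih]

/-- A sale lengthens each bidder's state only by an additive amount, since sums of prices gain few
digits. -/
theorem sz_exec_le (G : ℕ) (X : Input) (r : List ℕ) :
    sz (exec G X r) ≤ (sz r + 1) + sz X.1 + sz (initial X).2.2 +
      sz r * (X.2.length * (3 * sz r + (sz r + 1))) + 2 := by
  -- Working with suffixes of a fixed `r` gives the same increment in every round.
  have key : ∀ l, l <:+ r → sz (exec G X l).2.2 ≤ sz (initial X).2.2 +
      l.length * (X.2.length * (3 * sz r + (sz r + 1))) := by
    intro l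
    induction l with
    | nil => intro _; simp
    | cons q l ih =>
      intro h
      have h₁ := ih ((List.suffix_cons q l).trans h)
      have h₂ := sz_sell_le G (l.length + 1) q (exec G X l).2.2 ((exec G X l).2.1.headD 0)
      have h₃ : sz q ≤ sz r := (sz_le_of_mem (h.subset (by simp))).le
      have h₄ : sz (l.length + 1) ≤ sz r + 1 := by
        have := sz_nat_le (l.length + 1)
        have := h.length_le
        have := length_lt_sz r
        rw [List.length_cons] at *
        omega
      have h₅ : (exec G X l).2.2.length * (3 * sz q + sz (l.length + 1)) ≤
          X.2.length * (3 * sz r + (sz r + 1)) := by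
        rw [length_exec]; gcongr
      rw [exec_cons, offer, List.length_cons, Nat.add_mul, exec_fst]
      dsimp only
      omega
  have h₁ := key r List.suffix_rfl
  have h₂ := length_lt_sz r
  have h₃ := sz_nat_le r.length
  have h₄ := sz_drop_le X.1 r.length
  have h₅ : r.length * (X.2.length * (3 * sz r + (sz r + 1))) ≤
    sz r * (X.2.length * (3 * sz r + (sz r + 1))) := by gcongr
  rw [sz_prod, sz_prod, exec_fst, exec_copies]
  omega

section

variable {α : Type} [Enc α]

@[fun_prop]
theorem polyTime_sell (G : ℕ) {k q C : α → ℕ} {l : α → List Bidder} (hk : PolyTime k)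
    (hq : PolyTime q) (hC : PolyTime C) (hl : PolyTime l) :
    PolyTime fun x => sell G (k x) (q x) (C x) (l x) := by
  have : PolyTime fun x => (l x).foldl (fun (a : ℕ × List Bidder) s =>
      if 0 < a.1 ∧ s.Willing G (q x) then (a.1 - 1, s.buy (k x) (q x) :: a.2)
      else (a.1, s.pass :: a.2)) (C x, []) := by
    refine PolyTime.foldl_of_growth (init := fun x => (C x, ([] : List Bidder)))
      (step := fun x (a : ℕ × List Bidder) s => if 0 < a.1 ∧ s.Willing G (q x) then (a.1 - 1, s.buy (k x) (q x) :: a.2)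
      else (a.1, s.pass :: a.2)) (by fun_prop) hl (by fun_prop)
      (hl.polyBd.add (((PolyBd.const 3).mul hq.polyBd).add hk.polyBd)) fun x s hs a => ?_
    have h₁ := s.sz_buy_le (k x) (q x)
    have h₂ := s.sz_pass_le
    have h₃ := PolyTime.sz_nat_mono (Nat.sub_le a.1 1)
    have h₄ := sz_le_of_mem hs
    rw [sz_prod a]
    split <;> simp only [sz_mk, sz_cons] <;> omega
  have := this.snd.reverse
  simpa [sell_eq_foldl] using this

@[fun_prop]
theorem polyTime_offer (G : ℕ) {f : α → ℕ × List ℕ × List Bidder} {q : α → ℕ} (hf : PolyTime f)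
    (hq : PolyTime q) : PolyTime fun x => offer G (f x) (q x) := by
  unfold offer; fun_prop

@[fun_prop]
theorem polyTime_initial {X : α → Input} (hX : PolyTime X) : PolyTime fun x => initial (X x) := by
  have : PolyTime fun x => (X x).2.map fun v => ((v, 0, 0, 0, 0) : Bidder) :=
    PolyTime.map (f := fun _ v => ((v, 0, 0, 0, 0) : Bidder)) (by fun_prop) (by fun_prop)
  unfold initial; fun_prop

@[fun_prop]
theorem polyTime_exec (G : ℕ) {X : α → Input} {r : α → List ℕ} (hX : PolyTime X)
    (hr : PolyTime r) : PolyTime fun x => exec G (X x) (r x) := by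
  have h : ∀ x, exec G (X x) (r x) = (r x).reverse.foldl (offer G) (initial (X x)) := fun x => by
    rw [List.foldl_reverse]; rfl
  simp only [h]
  have h₀ : PolyTime fun x => (initial (X x)).2.2 := (polyTime_initial hX).snd.snd
  have h₁ := hr.polyBd
  have h₂ : PolyTime fun x => (X x).1 := by fun_prop
  have h₃ : PolyTime fun x => (X x).2 := by fun_prop
  refine PolyTime.foldl (step := fun _ st q => offer G st q) (by fun_prop) (by fun_prop)
    (by fun_prop) (((((h₁.add (.const 1)).add h₂.polyBd).add h₀.polyBd).add (h₁.mul
      (h₃.polyBd.mul (((PolyBd.const 3).mul h₁).add (h₁.add (.const 1)))))).add (.const 2))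
    fun x l hl => ?_
  have h₄ := sz_exec_le G (X x) l.reverse
  have h₅ : sz l.reverse ≤ sz (r x) := by
    obtain ⟨l', hl'⟩ := hl
    rw [sz_reverse, ← sz_reverse (r x), ← hl']
    have := sz_append l l'
    have := sz_pos l'
    omega
  have h₆ : l.foldl (offer G) (initial (X x)) = exec G (X x) l.reverse := by
    rw [exec, List.foldr_reverse]
  change sz (l.foldl (offer G) (initial (X x))) ≤ _
  rw [h₆]
  refine h₄.trans ?_
  have := length_lt_sz (X x).2
  gcongr

@[fun_prop]
theorem polyTime_revenue (G : ℕ) {X : α → Input} {r : α → List ℕ} (hX : PolyTime X)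
    (hr : PolyTime r) : PolyTime fun x => revenue G (X x) (r x) := by
  have : PolyTime fun x => ((exec G (X x) (r x)).2.2.map Bidder.spent) :=
    PolyTime.map (f := fun _ s => Bidder.spent s) (by fun_prop) (by fun_prop)
  unfold revenue; fun_prop

@[fun_prop]
theorem polyTime_best (G : ℕ) {X : α → Input} {l : α → List (List ℕ)} (hX : PolyTime X)
    (hl : PolyTime l) : PolyTime fun x => best G (X x) (l x) := by
  refine PolyTime.foldl_of_growth
    (step := fun x a r => if revenue G (X x) a ≤ revenue G (X x) r then r else a) (by fun_prop) hl
    (by fun_prop) hl.polyBd fun x r hr a => ?_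
  have := sz_le_of_mem hr
  split <;> omega

@[fun_prop]
theorem polyTime_prune (G : ℕ) {X : α → Input} {l : α → List (List ℕ)} (hX : PolyTime X)
    (hl : PolyTime l) : PolyTime fun x => prune G (X x) (l x) := by
  have h₁ : PolyTime fun x => List.range ((X x).1.length + 1) :=
    PolyTime.range_length (g := fun x => 0 :: (X x).1) (by fun_prop)
  refine PolyTime.map (f := fun x e => best G (X x) ((l x).filter fun r => decide (r.length = e)))
    ?_ h₁
  have h₂ : PolyTime fun z : α × ℕ => (l z.1).filter fun r => decide (r.length = z.2) :=
    PolyTime.filter (p := fun (z : α × ℕ) (r : List ℕ) => decide (r.length = z.2)) (by fun_prop)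
      (by fun_prop)
  fun_prop

/-- The list `l` serves as a unary counter; each new list is the previous one with one more `q`. -/
theorem extend_eq_foldl (q : ℕ) (r : List ℕ) (l : List ℕ) :
    l.foldl (fun (s : List (List ℕ)) _ => (q :: s.headD []) :: s) [r] = extend q l.length r := by
  induction l using List.reverseRecOn with
  | nil => simp [extend]
  | append_singleton l b ih =>
    rw [List.foldl_concat, ih]
    simp [extend, List.range_succ, List.replicate_succ]

theorem sz_replicate_append_le (e q : ℕ) (r : List ℕ) :
    sz (List.replicate e q ++ r) = e * (sz q + 1) + sz r := by
  induction e with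
  | zero => simp
  | succ e ih => rw [List.replicate_succ, List.cons_append, sz_cons, ih, Nat.add_mul]; omega

@[fun_prop]
theorem polyTime_extend {q : α → ℕ} {n : α → List ℕ} {r : α → List ℕ} (hq : PolyTime q)
    (hn : PolyTime n) (hr : PolyTime r) : PolyTime fun x => extend (q x) (n x).length (r x) := by
  simp only [← extend_eq_foldl]
  have h := (hn.polyBd.mul (hq.polyBd.add (.const 1))).add hr.polyBd
  refine PolyTime.foldl (step := fun x (s : List (List ℕ)) _ => (q x :: s.headD []) :: s)
    (by fun_prop) hn (by fun_prop)
    (((hn.polyBd.add (.const 1)).mul (h.add (.const 1))).add (.const 1)) fun x l hl => ?_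
  rw [extend_eq_foldl]
  have h₁ : l.length ≤ sz (n x) := hl.length_le.trans (length_lt_sz _).le
  refine (sz_le_of_forall (M := sz (n x) * (sz (q x) + 1) + sz (r x)) ?_).trans ?_
  · intro a ha
    simp only [extend, List.map_reverse, List.mem_reverse, List.mem_map, List.mem_range] at ha
    obtain ⟨e, he, rfl⟩ := ha
    rw [sz_replicate_append_le]
    gcongr
    omega
  · have : (extend (q x) l.length (r x)).length = l.length + 1 := by simp [extend]
    rw [this]
    gcongr

@[fun_prop]
theorem polyTime_branch {X : α → Input} {q : α → ℕ} {l : α → List (List ℕ)} (hX : PolyTime X)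
    (hq : PolyTime q) (hl : PolyTime l) : PolyTime fun x => branch (X x) (q x) (l x) :=
  PolyTime.flatMap (f := fun x r => extend (q x) (X x).1.length r) (by fun_prop) hl

end

/-! ### The levels -/

theorem level_strictMono (N : ℕ) : StrictMono (level N) :=
  strictMono_nat_of_lt_succ fun k => by
    rw [level]; exact Nat.lt_succ_of_le (Nat.le_add_right _ _)

/-- Each step adds at least `level N k / N` as a rational number. Thus `N` steps double a level, and
`j` steps multiply it by at least `1 + j / N`. -/
theorem level_growth {N : ℕ} (hN : 0 < N) (k j : ℕ) :
    level N k * (N + j) ≤ level N (k + j) * N := by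
  induction j with
  | zero => simp
  | succ j ih =>
    have h₁ : level N k ≤ level N (k + j) := (level_strictMono N).monotone (by omega)
    have h₂ := Nat.lt_mul_div_succ (level N (k + j)) hN
    rw [← Nat.add_assoc k, level]
    nlinarith

/-- Levels double every `N` steps, so the number of levels is linear in the binary length of the
values. -/
theorem topLevel_le {N : ℕ} (hN : 0 < N) (V : ℕ) : topLevel N V ≤ N * Nat.size V + 1 := by
  have h : ∀ s, 2 ^ s ≤ level N (N * s + 1) := fun s => by
    induction s with
    | zero => simp [level]
    | succ s ih =>
      have := level_growth hN (N * s + 1) N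
      rw [pow_succ, show N * (s + 1) + 1 = N * s + 1 + N by ring]
      nlinarith
  exact Nat.find_min' _ ((Nat.lt_size_self V).trans_le (h _))

theorem lt_level_topLevel (N V : ℕ) : V < level N (topLevel N V) :=
  Nat.find_spec (exists_lt_level N V)

theorem mem_levels {N k q : ℕ} : q ∈ levels N k ↔ ∃ j < k, level N j = q := by
  induction k with
  | zero => simp [levels]
  | succ k ih =>
    rw [levels, List.mem_cons, ih]
    constructor
    · rintro (rfl | ⟨j, hj, rfl⟩)
      exacts [⟨k, by omega, rfl⟩, ⟨j, by omega, rfl⟩]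
    · rintro ⟨j, hj, rfl⟩
      rcases Nat.lt_succ_iff_lt_or_eq.1 hj with h | rfl
      exacts [.inr ⟨j, h, rfl⟩, .inl rfl]

@[simp]
theorem length_levels (N k : ℕ) : (levels N k).length = k := by
  induction k with
  | zero => rfl
  | succ k ih => simp [levels, ih]

theorem sz_level_le {N : ℕ} (k : ℕ) : sz (level N k) ≤ 2 * k + 2 := by
  have : level N k < 2 ^ (2 * k + 1) := by
    induction k with
    | zero => simp [level]
    | succ k ih =>
      have := Nat.div_le_self (level N k) N
      have h₁ : 1 ≤ 2 ^ (2 * k + 1) := Nat.one_le_two_pow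
      rw [level, show 2 * (k + 1) + 1 = (2 * k + 1) + 1 + 1 by ring, pow_succ, pow_succ]
      omega
  have := Nat.size_le.2 this
  rw [sz_nat]; omega

/-! ### Length of the price lists -/

theorem best_mem (G : ℕ) (X : Input) (l : List (List ℕ)) : best G X l = [] ∨ best G X l ∈ l := by
  have h : ∀ a, l.foldl (fun a r => if revenue G X a ≤ revenue G X r then r else a) a = a ∨
      l.foldl (fun a r => if revenue G X a ≤ revenue G X r then r else a) a ∈ l := by
    induction l with
    | nil => simp
    | cons r l ih =>
      intro a
      rw [List.foldl_cons]
      rcases ih (if revenue G X a ≤ revenue G X r then r else a) with h | h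
      · rw [h]; split <;> simp
      · simp [h]
  exact h []

theorem mem_prune {G : ℕ} {X : Input} {l : List (List ℕ)} {r : List ℕ} (h : r ∈ prune G X l) :
    r = [] ∨ r ∈ l := by
  obtain ⟨e, -, rfl⟩ := List.mem_map.1 h
  rcases best_mem G X (l.filter fun r => decide (r.length = e)) with h | h
  · exact .inl h
  · exact .inr (List.mem_filter.1 h).1

theorem mem_extend {q n : ℕ} {r r' : List ℕ} :
    r' ∈ extend q n r ↔ ∃ e ≤ n, List.replicate e q ++ r = r' := by
  simp [extend]

theorem mem_branch {X : Input} {q : ℕ} {l : List (List ℕ)} {r' : List ℕ} :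
    r' ∈ branch X q l ↔ ∃ r ∈ l, ∃ e ≤ X.1.length, List.replicate e q ++ r = r' := by
  simp [branch, mem_extend]

theorem length_branch (X : Input) (q : ℕ) (l : List (List ℕ)) :
    (branch X q l).length = l.length * (X.1.length + 1) := by
  simp [branch, List.length_flatMap, extend]

@[simp]
theorem length_prune (G : ℕ) (X : Input) (l : List (List ℕ)) :
    (prune G X l).length = X.1.length + 1 := by
  simp [prune]

theorem nextPhase_lt {T c : ℕ} (h : c < T) : nextPhase T c < T := by
  unfold nextPhase; split <;> omega

theorem sweep_concat (G T g : ℕ) (X : Input) (c : ℕ) (L : List ℕ) (q : ℕ) :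
    sweep G T g X c (L ++ [q]) = sweepStep G T g X (sweep G T g X c L) q := by
  rw [sweep, List.foldl_concat]; rfl

theorem sweep_fst_lt {G T g : ℕ} {X : Input} {c : ℕ} (hc : c < T) (L : List ℕ) :
    (sweep G T g X c L).1 < T := by
  induction L using List.reverseRecOn with
  | nil => simpa [sweep]
  | append_singleton L q ih => rw [sweep_concat]; exact nextPhase_lt ih

theorem sweep_forall {G T g : ℕ} {X : Input} {c : ℕ} (L : List ℕ) :
    ∀ r ∈ (sweep G T g X c L).2, r.length ≤ L.length * X.1.length ∧ ∀ y ∈ r, y ∈ L := by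
  induction L using List.reverseRecOn with
  | nil => simp [sweep]
  | append_singleton L q ih =>
    rw [sweep_concat, sweepStep]
    intro r hr
    have h₁ : (L ++ [q]).length * X.1.length = L.length * X.1.length + X.1.length := by
      simp [Nat.add_mul]
    rw [h₁]
    dsimp only at hr
    split at hr
    · rcases mem_prune hr with rfl | h
      · simp
      · exact ⟨(ih r h).1.trans (Nat.le_add_right _ _), fun y hy => by simp [(ih r h).2 y hy]⟩
    · obtain ⟨r', hr', e, he, rfl⟩ := mem_branch.1 hr
      refine ⟨?_, fun y hy => ?_⟩
      · have := (ih r' hr').1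
        simp; omega
      · rcases List.mem_append.1 hy with h | h
        · simp [List.eq_of_mem_replicate h]
        · simp [(ih r' hr').2 y h]

/-- Phase `0` prunes because `0 < g`, leaving one list per length; every later phase of the cycle
multiplies the number by at most the number of items plus one. In the exponent, phase `0` counts as
`T`, as at the end of a cycle. -/
theorem length_sweep_le {G T g : ℕ} {X : Input} {c : ℕ} (hc : c < T) (hg : 0 < g) (L : List ℕ) :
    (sweep G T g X c L).2.length ≤ (X.1.length + 1) ^ (T + 1) := by
  have key : (sweep G T g X c L).2.length ≤ (X.1.length + 1) ^
      ((if (sweep G T g X c L).1 = 0 then T else (sweep G T g X c L).1) + 1) := by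
    induction L using List.reverseRecOn with
    | nil =>
      simp only [sweep, List.foldl_nil, List.length_singleton]
      exact Nat.one_le_pow _ _ (by omega)
    | append_singleton L q ih =>
      have h₁ := sweep_fst_lt (G := G) (g := g) (X := X) hc L
      rw [sweep_concat, sweepStep]
      generalize sweep G T g X c L = s at *
      have h₂ : (if nextPhase T s.1 = 0 then T else nextPhase T s.1) = s.1 + 1 := by
        by_cases h : s.1 + 1 = T <;> simp [nextPhase, h]
      rw [h₂]
      dsimp only
      split
      · rw [length_prune]
        exact Nat.le_self_pow (by omega) _
      · rw [length_branch, pow_succ]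
        rw [if_neg (by omega)] at ih
        gcongr
  refine key.trans (Nat.pow_le_pow_right (by omega) ?_)
  have h₁ := sweep_fst_lt (G := G) (g := g) (X := X) hc L
  split <;> omega

section

variable {α : Type} [Enc α]

@[fun_prop]
theorem polyTime_nextPhase (T : ℕ) {c : α → ℕ} (hc : PolyTime c) :
    PolyTime fun x => nextPhase T (c x) := by
  unfold nextPhase; fun_prop

theorem polyTime_sweep {G T g c : ℕ} {X : α → Input} {L : α → List ℕ} (hc : c < T) (hg : 0 < g)
    (hX : PolyTime X) (hL : PolyTime L) : PolyTime fun x => sweep G T g (X x) c (L x) := by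
  have hn : PolyTime fun x => (X x).1 := by fun_prop
  have hM := (((hL.polyBd.mul hn.polyBd).mul (hL.polyBd.add (.const 1))).add (.const 1))
  refine PolyTime.foldl (step := fun x s q => sweepStep G T g (X x) s q) (by fun_prop) hL ?_
    ((((hn.polyBd.add (.const 1)).pow (T + 1)).mul (hM.add (.const 1))).add (.const (T + 3)))
    fun x l hl => ?_
  · unfold sweepStep; fun_prop
  · change sz (sweep G T g (X x) c l) ≤ _
    have h₁ := sweep_fst_lt (G := G) (g := g) (X := X x) hc l
    have h₂ := sz_nat_le (sweep G T g (X x) c l).1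
    have h₃ := sz_le_of_forall (l := (sweep G T g (X x) c l).2)
      (M := sz (L x) * sz (X x).1 * (sz (L x) + 1) + 1) fun r hr => by
        obtain ⟨h₄, h₅⟩ := sweep_forall l r hr
        refine (sz_le_of_forall (M := sz (L x)) fun y hy =>
          (sz_le_of_mem (hl.subset (h₅ y hy))).le).trans ?_
        have h₆ := hl.length_le.trans (length_lt_sz (L x)).le
        have h₇ := (length_lt_sz (X x).1).le
        gcongr
        exact h₄.trans (by gcongr)
    have h₄ : (sweep G T g (X x) c l).2.length ≤ (sz (X x).1 + 1) ^ (T + 1) :=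
      (length_sweep_le hc hg l).trans (by have := (length_lt_sz (X x).1).le; gcongr)
    have h₅ : (sweep G T g (X x) c l).2.length *
        (sz (L x) * sz (X x).1 * (sz (L x) + 1) + 1 + 1) ≤
        (sz (X x).1 + 1) ^ (T + 1) * (sz (L x) * sz (X x).1 * (sz (L x) + 1) + 1 + 1) := by
      gcongr
    rw [sz_prod]
    omega

theorem polyTime_candidates {G T g k : ℕ} {X : α → Input} {L : α → List ℕ} (hk : k ≤ T)
    (hg : 0 < g) (hX : PolyTime X) (hL : PolyTime L) :
    PolyTime fun x => candidates G T g (X x) (L x) k := by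
  induction k with
  | zero => exact .const _
  | succ k ih => exact (polyTime_sweep hk hg hX hL).snd.append (ih (by omega))

@[fun_prop]
theorem polyTime_total {X : α → Input} (hX : PolyTime X) : PolyTime fun x => total (X x) := by
  have : PolyTime fun x => (X x).2.map List.sum :=
    PolyTime.map (f := fun _ l => List.sum l) (by fun_prop) (by fun_prop)
  unfold total; fun_prop

/-- Levels are prepended until the newest exceeds `V x`; `topLevel_le` bounds the number of rounds.
-/
theorem polyTime_levels {N : ℕ} (hN : 0 < N) {V : α → ℕ} (hV : PolyTime V) :
    PolyTime fun x => levels N (topLevel N (V x) + 1) := by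
  let f : ℕ × List ℕ → ℕ × List ℕ := fun s => (s.1, (s.2.headD 0 + s.2.headD 0 / N + 1) :: s.2)
  have hf : ∀ V i, f^[i] (V, [0]) = (V, levels N (i + 1)) := fun V i => by
    induction i with
    | zero => simp [levels, level]
    | succ i ih => rw [Function.iterate_succ_apply', ih]; simp [f, levels, level]
  have hJ : ∀ x, topLevel N (V x) ≤ N * sz (V x) + 1 := fun x =>
    (topLevel_le hN (V x)).trans (by rw [sz_nat]; gcongr; omega)
  have hn : PolyBd fun x => N * sz (V x) + 1 := ((PolyBd.const N).mul hV.polyBd).add (.const 1)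
  have := PolyTime.iterate (init := fun x => (V x, [0]))
    (c := fun s : ℕ × List ℕ => decide (s.2.headD 0 ≤ s.1)) (f := f)
    (n := fun x => topLevel N (V x)) (by fun_prop) (by fun_prop) (by fun_prop)
    (hn.mono hJ)
    ((hV.polyBd.add ((hn.add (.const 1)).mul ((((PolyBd.const 2).mul hn).add (.const 2)).add
      (.const 1)))).add (.const 2)) ?_ ?_ ?_
  · refine this.snd.of_enc_eq fun x => ?_
    simp only [hf]
  · intro x i hi
    rw [hf]
    simpa [levels] using Nat.find_min (exists_lt_level N (V x)) hi
  · intro x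
    rw [hf]
    simpa [levels] using lt_level_topLevel N (V x)
  · intro x i hi
    have h₁ := hJ x
    have h₂ := sz_le_of_forall (l := levels N (i + 1)) (M := 2 * (N * sz (V x) + 1) + 2)
      fun q hq => by
        obtain ⟨j, hj, rfl⟩ := mem_levels.1 hq
        exact (sz_level_le j).trans (by omega)
    rw [length_levels] at h₂
    have h₃ : (i + 1) * (2 * (N * sz (V x) + 1) + 2 + 1) ≤
        (N * sz (V x) + 1 + 1) * (2 * (N * sz (V x) + 1) + 2 + 1) := by gcongr; omega
    rw [hf, sz_mk]
    omega

theorem polyTime_select {N G T g : ℕ} (hN : 0 < N) (hg : 0 < g) : PolyTime (select N G T g) :=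
  polyTime_best G .id (polyTime_candidates le_rfl hg .id (polyTime_levels hN (by fun_prop)))

@[fun_prop]
theorem polyTime_output (G : ℕ) {X : α → Input} {r : α → List ℕ} (hX : PolyTime X)
    (hr : PolyTime r) : PolyTime fun x => output G (X x) (r x) := by
  have h₁ : PolyTime fun x => (List.range (X x).1.length).map fun i =>
      ((r x).reverse.getD i 0, 1) :=
    PolyTime.map (f := fun x i => ((r x).reverse.getD i 0, 1)) (by fun_prop) (by fun_prop)
  have h₂ : PolyTime fun x => (exec G (X x) (r x)).2.2.map Bidder.item :=
    PolyTime.map (f := fun _ s => Bidder.item s) (by fun_prop) (by fun_prop)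
  unfold output; fun_prop

end

/-! ### Properties of the states -/

/-- What is known about a bidder with values `v` after items have been offered at the prices in
`r`. -/
structure Bidder.Valid (G : ℕ) (X : Input) (r v : List ℕ) (s : Bidder) : Prop where
  values : s.1 = v.drop r.length
  potential : s.spent * (G - 1) + s.last ≤ G * s.first
  first_le : s.first ≤ s.spent
  first_of_item : s.item = 0 → s.first = 0
  of_item : s.item ≠ 0 → ∃ i < r.length, s.item = i + 1 ∧ i < X.1.length ∧
    s.first = r.reverse.getD i 0 ∧ s.first ≤ v.getD i 0 ∧ s.last ∈ r ∧ s.first ∈ r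

theorem forall₂_sell {β : Type} {G k q C : ℕ} {P Q : β → Bidder → Prop} {vs : List β}
    {l : List Bidder} (h : List.Forall₂ P vs l) (hpass : ∀ v s, P v s → Q v s.pass)
    (hbuy : ∀ v s, 0 < C → s.Willing G q → P v s → Q v (s.buy k q)) :
    List.Forall₂ Q vs (sell G k q C l) := by
  induction h generalizing C with
  | nil => exact .nil
  | cons h _ ih =>
    rw [sell]
    split
    case isTrue hC =>
      exact .cons (hbuy _ _ hC.1 hC.2 h) (ih fun v s h => hbuy v s hC.1)
    case isFalse => exact .cons (hpass _ _ h) (ih hbuy)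

theorem forall₂_of_forall₂ {α β γ : Type} {P : α → β → Prop} {Q : α → γ → Prop}
    {R : β → γ → Prop} (h : ∀ a b c, P a b → Q a c → R b c) {l : List α} {l₁ : List β}
    {l₂ : List γ} (h₁ : List.Forall₂ P l l₁) (h₂ : List.Forall₂ Q l l₂) :
    List.Forall₂ R l₁ l₂ := by
  induction h₁ generalizing l₂ with
  | nil => cases h₂; exact .nil
  | cons h' _ ih =>
    cases h₂ with
    | cons h₃ h₄ => exact .cons (h _ _ _ h' h₃) (ih h₄)

theorem exists_of_forall₂ {α β : Type} {P : α → β → Prop} {l : List α} {l' : List β}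
    (h : List.Forall₂ P l l') {b : β} (hb : b ∈ l') : ∃ a ∈ l, P a b := by
  induction h with
  | nil => simp at hb
  | cons h _ ih =>
    rcases List.mem_cons.1 hb with rfl | hb
    · exact ⟨_, by simp, h⟩
    · obtain ⟨a, ha, h⟩ := ih hb
      exact ⟨a, by simp [ha], h⟩

theorem getD_drop_zero (l : List ℕ) (i : ℕ) : (l.drop i).headD 0 = l.getD i 0 := by
  rw [List.headD_eq_head?_getD, List.head?_drop, List.getD_eq_getElem?_getD]

/-- The potential is the telescoped geometric series. A first purchase gives equality, as `q * (G -
1) + q = G * q`. A repeated one raises `spent * (G - 1) + last` by `q * (G - 1) + q - last = G * q -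
last`, which is not positive for a willing bidder. -/
theorem exec_valid {G : ℕ} (hG : 0 < G) (X : Input) (r : List ℕ) :
    List.Forall₂ (Bidder.Valid G X r) X.2 (exec G X r).2.2 := by
  induction r with
  | nil =>
    rw [exec_nil, initial]
    dsimp only
    rw [List.forall₂_map_right_iff, List.forall₂_same]
    intro v _
    constructor <;> simp [Bidder.spent, Bidder.last, Bidder.first, Bidder.item]
  | cons q r ih =>
    rw [exec_cons, offer]
    refine forall₂_sell ih (fun v s h => ?_) fun v s hC hw h => ?_
    · obtain ⟨h₁, h₂, h₃, h₄, h₅⟩ := h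
      refine ⟨?_, h₂, h₃, h₄, fun hi => ?_⟩
      · simp [Bidder.pass, h₁]
      · obtain ⟨i, hi, h₆, h₇, h₈, h₉, h₁₀, h₁₁⟩ := h₅ hi
        refine ⟨i, by simp; omega, h₆, h₇, ?_, h₉,
          List.mem_cons_of_mem _ h₁₀, ?_⟩
        · rw [List.reverse_cons, List.getD_append _ _ _ _ (by simpa)]; exact h₈
        · exact List.mem_cons_of_mem _ h₁₁
    · obtain ⟨h₁, h₂, h₃, h₄, h₅⟩ := h
      obtain ⟨G, rfl⟩ : ∃ G', G = G' + 1 := ⟨G - 1, by omega⟩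
      rw [exec_copies, getD_drop_zero] at hC
      obtain ⟨hw₁, hw₂⟩ := hw
      rw [h₁, getD_drop_zero] at hw₁
      by_cases hs : s.item = 0
      · have e : s.buy (r.length + 1) q = (s.1.tail, q, r.length + 1, s.spent + q, q) := by
          simp [Bidder.buy, hs]
        rw [exec_fst, e]
        have h₆ := h₄ hs
        rw [h₆] at h₂
        -- Beyond the end of the list the default number of copies is `0`, so a sale shows that the
        -- item exists.
        have hX : r.length < X.1.length := by
          by_contra h
          rw [List.getD_eq_default _ _ (by omega)] at hC
          omega
        constructor
        · simp [h₁]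
        · simp only [Bidder.spent, Bidder.last, Bidder.first, Nat.add_sub_cancel] at *
          nlinarith
        · simp [Bidder.first, Bidder.spent]
        · simp [Bidder.item]
        · intro _
          refine ⟨r.length, by simp, rfl, hX, ?_, hw₁, ?_, ?_⟩ <;>
            simp [Bidder.first, Bidder.last]
      · have e : s.buy (r.length + 1) q = (s.1.tail, q, s.item, s.spent + q, s.first) := by
          simp [Bidder.buy, hs]
        rw [exec_fst, e]
        obtain ⟨i, hi, h₆, h₇, h₈, h₉, h₁₀, h₁₁⟩ := h₅ hs
        have hw₃ := hw₂.resolve_left hs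
        constructor
        · simp [h₁]
        · simp only [Bidder.spent, Bidder.last, Bidder.first, Nat.add_sub_cancel] at *
          nlinarith
        · simp only [Bidder.first, Bidder.spent] at *; omega
        · intro h; exact absurd h hs
        · intro _
          refine ⟨i, by simp; omega, h₆, h₇, ?_, h₉, ?_, ?_⟩
          · rw [List.reverse_cons, List.getD_append _ _ _ _ (by simpa)]; exact h₈
          · simp [Bidder.last]
          · exact List.mem_cons_of_mem _ h₁₁

/-! ### Limited supply -/

theorem countP_sell_le (G k q C : ℕ) (l : List Bidder) :
    (sell G k q C l).countP (fun s => s.item = k) ≤ C + l.countP fun s => s.item = k := by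
  induction l generalizing C with
  | nil => simp [sell]
  | cons s l ih =>
    rw [sell]
    split
    case isTrue h =>
      have := ih (C - 1)
      rw [List.countP_cons, List.countP_cons]
      have h' := h.1
      split_ifs <;> omega
    case isFalse =>
      rw [List.countP_cons, List.countP_cons]
      have := ih C
      have e : s.pass.item = s.item := rfl
      rw [e]
      omega

theorem countP_sell_of_ne {G k q k' : ℕ} (hk : k' ≠ k) (C : ℕ) (l : List Bidder) :
    (sell G k q C l).countP (fun s => s.item = k') ≤ l.countP fun s => s.item = k' := by
  induction l generalizing C with
  | nil => simp [sell]
  | cons s l ih =>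
    have h₁ := ih (C - 1)
    have h₂ := ih C
    rw [sell]
    split
    · rw [List.countP_cons, List.countP_cons]
      have e : (s.buy k q).item = if s.item = 0 then k else s.item := rfl
      have : (s.buy k q).item = k' → s.item = k' := by
        rw [e]; split <;> simp [hk.symm]
      by_cases h : s.item = k'
      · simp only [h, decide_true, if_true]; split <;> omega
      · have h' : ¬ (s.buy k q).item = k' := fun h' => h (this h')
        simp only [h, h', decide_false, Bool.false_eq_true, if_false]
        omega
    · rw [List.countP_cons, List.countP_cons]
      have e : s.pass.item = s.item := rfl
      rw [e]
      omega

/-- A bidder acquires the number `i + 1` only in the round in which this item is offered: before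
that no state carries it, and later rounds cannot add it. -/
theorem countP_exec_le {G : ℕ} (hG : 0 < G) (X : Input) (r : List ℕ) (i : ℕ) :
    (exec G X r).2.2.countP (fun s => s.item = i + 1) ≤ X.1.getD i 0 := by
  induction r with
  | nil =>
    have : (exec G X []).2.2.countP (fun s => s.item = i + 1) = 0 := by
      simp [List.countP_eq_zero, initial, Bidder.item]
    omega
  | cons q r ih =>
    rw [exec_cons, offer, exec_fst]
    dsimp only
    by_cases h : i = r.length
    · have h₁ : (exec G X r).2.2.countP (fun s => s.item = i + 1) = 0 := by
        rw [List.countP_eq_zero]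
        intro s hs
        obtain ⟨v, -, hv⟩ := exists_of_forall₂ (exec_valid hG X r) hs
        simp only [decide_eq_true_eq]
        intro h'
        obtain ⟨j, hj, h₂, -⟩ := hv.of_item (by omega)
        omega
      have h₂ := countP_sell_le G (r.length + 1) q ((exec G X r).2.1.headD 0) (exec G X r).2.2
      rw [exec_copies, getD_drop_zero] at h₂ ⊢
      subst h
      omega
    · exact (countP_sell_of_ne (by omega) _ _).trans ih

/-! ### Comparison with an arbitrary allocation -/

/-- Charging for one round, where `as` is the competing allocation. A sale pays `q` and uses up one
copy, which covers one copy of the competitor. A bidder with `a = i` who is refused although copies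
remain must own an item already; its first price is at least `q` and enters the sum now, when the
bound moves from `a < i` to `a < i + 1`. So each first price is charged at most once. -/
theorem sell_opt {G k q i C : ℕ} {as : List ℕ} {l : List Bidder}
    (h : List.Forall₂ (fun a s => (s.item = 0 → s.first = 0) ∧
      (a = i → q ≤ s.1.headD 0 ∧ (s.item ≠ 0 → q ≤ s.first))) as l) :
    q * min (as.count i) C + (List.zipWith (fun a s => if a < i then s.first else 0) as l).sum +
      (l.map Bidder.spent).sum ≤
    (List.zipWith (fun a s => if a < i + 1 then s.first else 0) as (sell G k q C l)).sum +
      ((sell G k q C l).map Bidder.spent).sum := by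
  induction h generalizing C with
  | nil => simp [sell]
  | @cons a s as l h _ ih =>
    rw [sell]
    have e : (s.buy k q).first = if s.item = 0 then q else s.first := rfl
    have e' : (s.buy k q).spent = s.spent + q := rfl
    have e'' : s.pass.first = s.first := rfl
    have e''' : s.pass.spent = s.spent := rfl
    obtain ⟨h₁, h₂⟩ := h
    split
    case isTrue hC =>
      have := ih (C := C - 1)
      have h₃ : q * min ((a :: as).count i) C ≤ q * min (as.count i) (C - 1) + q := by
        have : min ((a :: as).count i) C ≤ min (as.count i) (C - 1) + 1 := by
          rw [List.count_cons]; split <;> omega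
        calc _ ≤ q * (min (as.count i) (C - 1) + 1) := by gcongr
          _ = _ := by ring
      have h₄ : (if a < i then s.first else 0) ≤ if a < i + 1 then (s.buy k q).first else 0 := by
        rw [e]
        split_ifs <;> grind
      simp only [List.zipWith_cons_cons, List.sum_cons, List.map_cons, e']
      omega
    case isFalse hC =>
      have := ih (C := C)
      have h₃ : q * min ((a :: as).count i) C + (if a < i then s.first else 0) ≤
          q * min (as.count i) C + if a < i + 1 then s.first else 0 := by
        by_cases ha : a = i
        · subst ha
          rcases Nat.eq_zero_or_pos C with rfl | hC'
          · simp
          · have h₅ : ¬ s.Willing G q := fun h => hC ⟨hC', h⟩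
            have h₆ : q ≤ s.first := by
              obtain ⟨h₇, h₈⟩ := h₂ rfl
              by_contra h₉
              exact h₅ ⟨h₇, .inl (by by_contra h; exact h₉ (h₈ h))⟩
            have : min ((a :: as).count a) C ≤ min (as.count a) C + 1 := by
              rw [List.count_cons]; split <;> omega
            have : q * min ((a :: as).count a) C ≤ q * (min (as.count a) C + 1) := by gcongr
            rw [Nat.mul_add] at this
            rw [if_neg (lt_irrefl a), if_pos (Nat.lt_succ_self a)]
            omega
        · rw [List.count_cons_of_ne (by simpa using ha)]
          have : (a < i ↔ a < i + 1) := by omega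
          simp [this]
      simp only [List.zipWith_cons_cons, List.sum_cons, List.map_cons, e'', e''']
      omega

theorem sum_zipWith_first_le {G : ℕ} {X : Input} {r : List ℕ} (j : ℕ) {as : List ℕ}
    {vs : List (List ℕ)} {l : List Bidder} (h : List.Forall₂ (Bidder.Valid G X r) vs l) :
    (List.zipWith (fun a s => if a < j then Bidder.first s else 0) as l).sum ≤
      (l.map Bidder.spent).sum := by
  induction h generalizing as with
  | nil => simp
  | cons h _ ih =>
    cases as with
    | nil => simp
    | cons a as =>
      have h₁ := ih (as := as)
      have h₂ := h.first_le
      simp only [List.zipWith_cons_cons, List.sum_cons, List.map_cons]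
      split <;> omega

/-- At given prices, no allocation gets more than twice the revenue. -/
theorem le_two_mul_revenue {G : ℕ} (hG : 0 < G) {X : Input} {r as : List ℕ}
    (hr : r.Pairwise (· ≤ ·))
    (has : List.Forall₂ (fun v a => a < r.length → r.reverse.getD a 0 ≤ v.getD a 0) X.2 as)
    (hC : ∀ i < r.length, as.count i ≤ X.1.getD i 0) :
    (as.map fun a => if a < r.length then r.reverse.getD a 0 else 0).sum ≤
      2 * revenue G X r := by
  have key : (as.map fun a => if a < r.length then r.reverse.getD a 0 else 0).sum ≤
      (List.zipWith (fun a s => if a < r.length then Bidder.first s else 0) as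
        (exec G X r).2.2).sum + revenue G X r := by
    induction r with
    | nil => simp
    | cons q r ih =>
      rw [List.pairwise_cons] at hr
      have h₁ := ih hr.2 ?_ fun i hi => hC i (by simp; omega)
      · have h₂ := sell_opt (G := G) (k := r.length + 1) (q := q) (i := r.length)
          (C := X.1.getD r.length 0) (as := as) (l := (exec G X r).2.2) ?_
        · rw [min_eq_left (hC _ (by simp))] at h₂
          have h₃ : (as.map fun a => if a < (q :: r).length then
              (q :: r).reverse.getD a 0 else 0).sum = q * as.count r.length +
              (as.map fun a => if a < r.length then r.reverse.getD a 0 else 0).sum := by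
            clear has hC ih h₁ h₂
            induction as with
            | nil => simp
            | cons a as ih =>
              rw [List.map_cons, List.map_cons, List.sum_cons, List.sum_cons, ih, List.count_cons]
              rcases lt_trichotomy a r.length with h | h | h
              · rw [if_pos (by simp; omega), if_pos h, List.reverse_cons,
                  List.getD_append _ _ _ _ (by simpa), if_neg (by simpa using h.ne),
                  Nat.add_zero]
                omega
              · subst h
                simp
                ring
              · rw [if_neg (by simp; omega), if_neg (show ¬ a < r.length by omega),
                  if_neg (show ¬ (a == r.length) = true by simpa using h.ne'),
                  Nat.add_zero]
                omega
          rw [h₃]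
          unfold revenue at h₁ ⊢
          rw [exec_cons, offer, exec_fst, exec_copies, getD_drop_zero]
          dsimp only [List.length_cons]
          omega
        · refine forall₂_of_forall₂ (fun v a s h₅ h₆ => ?_) has (exec_valid hG X r)
          refine ⟨h₆.first_of_item, ?_⟩
          rintro rfl
          constructor
          · rw [h₆.values, getD_drop_zero]
            simpa using h₅ (by simp)
          · intro hi
            obtain ⟨i, -, -, -, -, -, -, h⟩ := h₆.of_item hi
            exact hr.1 _ h
      · refine has.imp fun v a h ha => ?_
        have := h (by simp; omega)
        rwa [List.reverse_cons, List.getD_append _ _ _ _ (by simpa)] at this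
  have := sum_zipWith_first_le (as := as) r.length (exec_valid hG X r)
  unfold revenue at *
  omega

/-! ### Independence of prices that are far apart -/

/-- Two bidders will behave in the same way when items are offered at prices in `E`. -/
def Bidder.Alike (G : ℕ) (E : List ℕ) (s t : Bidder) : Prop :=
  s.1 = t.1 ∧ ((s.item ≠ 0 ∧ t.item ≠ 0 ∧ s.last = t.last) ∨
    ∀ x ∈ E, (s.item = 0 ∨ G * x ≤ s.last) ∧ (t.item = 0 ∨ G * x ≤ t.last))

/-- Alike bidders decide alike, so copies run out at the same moment. A purchase makes both last
prices equal to `q`; without one, the states stay alike. The number `k` must not be `0`, the code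
for no item. -/
theorem sell_alike {G k q : ℕ} {E : List ℕ} (hq : q ∈ E) (hk : k ≠ 0) {l l' : List Bidder}
    (h : List.Forall₂ (Bidder.Alike G E) l l') (C : ℕ) :
    List.Forall₂ (Bidder.Alike G E) (sell G k q C l) (sell G k q C l') ∧
      ((sell G k q C l).map Bidder.spent).sum + (l'.map Bidder.spent).sum =
      ((sell G k q C l').map Bidder.spent).sum + (l.map Bidder.spent).sum := by
  induction h generalizing C with
  | nil => simp [sell]
  | @cons s t l l' h _ ih =>
    have hw : s.Willing G q ↔ t.Willing G q := by
      unfold Bidder.Willing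
      rw [h.1]
      rcases h.2 with ⟨h₁, h₂, h₃⟩ | h₁
      · simp [h₁, h₂, h₃]
      · simp [h₁ q hq]
    have h₁ := ih (C - 1)
    have h₂ := ih C
    rw [sell, sell]
    simp only [hw]
    split
    · refine ⟨.cons ⟨?_, .inl ⟨?_, ?_, rfl⟩⟩ h₁.1, ?_⟩
      · simp [Bidder.buy, h.1]
      · by_cases hs : s.2.2.1 = 0 <;> simp [Bidder.buy, Bidder.item, hs, hk]
      · by_cases ht : t.2.2.1 = 0 <;> simp [Bidder.buy, Bidder.item, ht, hk]
      · have e : (s.buy k q).spent = s.spent + q := rfl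
        have e' : (t.buy k q).spent = t.spent + q := rfl
        simp only [List.map_cons, List.sum_cons, e, e']
        omega
    · refine ⟨.cons ⟨?_, h.2⟩ h₂.1, ?_⟩
      · simp [Bidder.pass, h.1]
      · have e : s.pass.spent = s.spent := rfl
        have e' : t.pass.spent = t.spent := rfl
        simp only [List.map_cons, List.sum_cons, e, e']
        omega

/-- After `R` or `O`, every earlier purchase is too expensive to block a purchase at a price in `E`.
Equal lengths ensure that `E` applies to the same items, so it earns the same amount on top of
either list. -/
theorem revenue_append {G : ℕ} (hG : 0 < G) (X : Input) {E R O : List ℕ}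
    (hl : R.length = O.length) (hR : ∀ x ∈ E, ∀ y ∈ R, G * x ≤ y)
    (hO : ∀ x ∈ E, ∀ y ∈ O, G * x ≤ y) :
    revenue G X (E ++ R) + revenue G X O = revenue G X (E ++ O) + revenue G X R := by
  have key : ∀ F, F <:+ E →
      List.Forall₂ (Bidder.Alike G E) (exec G X (F ++ R)).2.2 (exec G X (F ++ O)).2.2 ∧
      revenue G X (F ++ R) + revenue G X O = revenue G X (F ++ O) + revenue G X R := by
    intro F
    induction F with
    | nil =>
      intro _
      refine ⟨forall₂_of_forall₂ (fun v s t hs ht => ⟨?_, .inr fun x hx => ⟨?_, ?_⟩⟩)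
        (exec_valid hG X R) (exec_valid hG X O), Nat.add_comm _ _⟩
      · rw [hs.values, ht.values, hl]
      · refine or_iff_not_imp_left.2 fun h => ?_
        obtain ⟨i, -, -, -, -, -, h, -⟩ := hs.of_item h
        exact hR _ hx _ h
      · refine or_iff_not_imp_left.2 fun h => ?_
        obtain ⟨i, -, -, -, -, -, h, -⟩ := ht.of_item h
        exact hO _ hx _ h
    | cons q F ih =>
      intro hF
      obtain ⟨h₁, h₂⟩ := ih ((List.suffix_cons q F).trans hF)
      have hl' : (F ++ R).length = (F ++ O).length := by simp [hl]
      have h₃ := sell_alike (k := (F ++ O).length + 1) (hF.subset (List.mem_cons_self ..))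
        (by omega) h₁ (X.1.getD (F ++ O).length 0)
      unfold revenue at h₂ ⊢
      rw [List.cons_append, List.cons_append, exec_cons, exec_cons, offer, offer, exec_fst,
        exec_fst, exec_copies, exec_copies, hl', getD_drop_zero]
      refine ⟨h₃.1, ?_⟩
      have := h₃.2
      dsimp only
      omega
  exact (key E List.suffix_rfl).2

/-! ### Optimality of the price lists found -/

theorem revenue_le_foldl_best (G : ℕ) (X : Input) (l : List (List ℕ)) (a : List ℕ) :
    ∀ r ∈ a :: l, revenue G X r ≤
      revenue G X (l.foldl (fun a r => if revenue G X a ≤ revenue G X r then r else a) a) := by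
  induction l generalizing a with
  | nil => simp
  | cons b l ih =>
    intro r hr
    rw [List.foldl_cons]
    have h := ih (if revenue G X a ≤ revenue G X b then b else a)
    have h' := h _ (List.mem_cons_self ..)
    rcases List.mem_cons.1 hr with rfl | hr
    · refine le_trans ?_ h'
      split <;> omega
    rcases List.mem_cons.1 hr with rfl | hr
    · refine le_trans ?_ h'
      split <;> omega
    · exact h _ (List.mem_cons_of_mem _ hr)

theorem revenue_le_best {G : ℕ} {X : Input} {l : List (List ℕ)} {r : List ℕ} (hr : r ∈ l) :
    revenue G X r ≤ revenue G X (best G X l) :=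
  revenue_le_foldl_best G X l [] r (List.mem_cons_of_mem _ hr)

theorem revenue_nil (G : ℕ) (X : Input) : revenue G X [] = 0 := by
  simp only [revenue, exec_nil, initial, List.map_map]
  exact List.sum_eq_zero (by simp [Bidder.spent])

/-- The starting value `[]` has revenue `0` and ties favour the newer list, so `[]` is displaced at
once. Pruning needs this in order to return a list of the prescribed length. -/
theorem best_mem_of_ne_nil (G : ℕ) (X : Input) {l : List (List ℕ)} (hl : l ≠ []) :
    best G X l ∈ l := by
  have h : ∀ (l : List (List ℕ)) a,
      l.foldl (fun a r => if revenue G X a ≤ revenue G X r then r else a) a ∈ a :: l := by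
    intro l
    induction l with
    | nil => simp
    | cons r l ih =>
      intro a
      rw [List.foldl_cons]
      rcases List.mem_cons.1 (ih (if revenue G X a ≤ revenue G X r then r else a)) with h | h
      · rw [h]; split <;> simp
      · exact List.mem_cons_of_mem _ (List.mem_cons_of_mem _ h)
  cases l with
  | nil => exact absurd rfl hl
  | cons r l =>
    rw [best, List.foldl_cons, revenue_nil, if_pos (Nat.zero_le _)]
    exact h l r

theorem exists_mem_prune {G : ℕ} {X : Input} {l : List (List ℕ)} {r : List ℕ} (hr : r ∈ l)
    (hn : r.length ≤ X.1.length) :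
    ∃ r' ∈ prune G X l, r' ∈ l ∧ r'.length = r.length ∧ revenue G X r ≤ revenue G X r' := by
  have h : r ∈ l.filter fun r' => decide (r'.length = r.length) := by simp [hr]
  have h' := best_mem_of_ne_nil G X (List.ne_nil_of_mem h)
  refine ⟨_, List.mem_map.2 ⟨r.length, by simp; omega, rfl⟩, (List.mem_filter.1 h').1, ?_,
    revenue_le_best h⟩
  simpa using (List.mem_filter.1 h').2

theorem sweepStep_sorted {N G T g : ℕ} {X : Input} {k c : ℕ} {l : List (List ℕ)}
    (h : ∀ r ∈ l, r.Pairwise (· ≤ ·) ∧ ∀ y ∈ r, level N (k + 1) ≤ y) :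
    ∀ r ∈ (sweepStep G T g X (c, l) (level N k)).2,
      r.Pairwise (· ≤ ·) ∧ ∀ y ∈ r, level N k ≤ y := by
  have hk := (level_strictMono N).monotone (Nat.le_succ k)
  intro r hr
  simp only [sweepStep] at hr
  split at hr
  · rcases mem_prune hr with rfl | hr
    · simp
    · exact ⟨(h r hr).1, fun y hy => hk.trans ((h r hr).2 y hy)⟩
  · obtain ⟨r', hr', e, -, rfl⟩ := mem_branch.1 hr
    obtain ⟨h₁, h₂⟩ := h r' hr'
    refine ⟨List.pairwise_append.2 ⟨?_, h₁, fun x hx y hy => ?_⟩, fun y hy => ?_⟩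
    · simp [List.pairwise_replicate]
    · rw [List.eq_of_mem_replicate hx]
      exact hk.trans (h₂ y hy)
    · rcases List.mem_append.1 hy with hy | hy
      · rw [List.eq_of_mem_replicate hy]
      · exact hk.trans (h₂ y hy)

theorem sweep_sorted {N G T g : ℕ} {X : Input} {k c : ℕ} {l : List (List ℕ)}
    (h : ∀ r ∈ l, r.Pairwise (· ≤ ·) ∧ ∀ y ∈ r, level N k ≤ y) :
    ∀ r ∈ ((levels N k).foldl (sweepStep G T g X) (c, l)).2, r.Pairwise (· ≤ ·) := by
  induction k generalizing c l with
  | zero => exact fun r hr => (h r hr).1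
  | succ k ih =>
    rw [levels, List.foldl_cons]
    exact ih (sweepStep_sorted (T := T) h)

/-- A price list `O` in which `i` has the price `level N (lev i)` unless this level is skipped, as it
develops during the algorithm, after the levels from `k` on. The algorithm has found a price list
that is at least as good in the completed cycles and agrees with `O` in the current one. -/
structure Follows (N G g : ℕ) (X : Input) (lev phase : ℕ → ℕ) (k c : ℕ) (l : List (List ℕ))
    (O : List ℕ) : Prop where
  all : c ≤ g → ∀ r ∈ l, ∀ y ∈ r, level N (k + c) ≤ y
  ge : ∀ r ∈ l, ∀ y ∈ r, level N k ≤ y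
  split : ∃ E R O', E ++ R ∈ l ∧ O = E ++ O' ∧ R.length = O'.length ∧
    revenue G X O' ≤ revenue G X R ∧ (∀ y ∈ R, level N (k + c) ≤ y) ∧
    (∀ y ∈ O', level N (k + c) ≤ y) ∧ (c ≤ g → E = []) ∧
    (∀ x ∈ E, ∀ y ∈ R, G * x ≤ y) ∧ (∀ x ∈ E, ∀ y ∈ O', G * x ≤ y)
  sorted : O.Pairwise (· ≤ ·)
  ge' : ∀ y ∈ O, level N k ≤ y
  lt_length : ∀ i < O.length, i < X.1.length ∧ k ≤ lev i
  price : ∀ i < X.1.length, k ≤ lev i → g ≤ phase (lev i) →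
    i < O.length ∧ O.reverse.getD i 0 = level N (lev i)

/-- Exchange argument. In a gap nothing of the current cycle is priced yet, so `R` may be replaced
by the best list of its length. Otherwise the target prices all pending items up to index `m k` at
the current level, and the enumeration contains the same move applied to `E ++ R`. When the cycle
closes, `revenue_append` turns the comparison of `R` with `O'` into one of the full lists. -/
theorem Follows.step {N G T g : ℕ} (hG : 0 < G) (hgT : g < T)
    (hgrow : ∀ k, G * level N k ≤ level N (k + g)) {X : Input} {lev phase m : ℕ → ℕ}
    (hm : ∀ i k, i < m k ↔ i < X.1.length ∧ k ≤ lev i) {k c : ℕ}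
    (hp : phase k = c) {l : List (List ℕ)} {O : List ℕ}
    (h : Follows N G g X lev phase (k + 1) c l O) :
    ∃ O', Follows N G g X lev phase k (sweepStep G T g X (c, l) (level N k)).1
      (sweepStep G T g X (c, l) (level N k)).2 O' := by
  have hmono := (level_strictMono N).monotone
  obtain ⟨E, R, O', hER, rfl, hl, hrev, hR, hO, hE, hER', hEO⟩ := h.split
  have hlen : (E ++ O').length ≤ X.1.length := by
    by_contra! hlt
    exact absurd (h.lt_length _ hlt).1 (lt_irrefl _)
  simp only [sweepStep]
  by_cases hcg : c < g
  · rw [if_pos hcg]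
    have hn : nextPhase T c = c + 1 := by unfold nextPhase; rw [if_neg (by omega)]
    have hE' := hE hcg.le
    subst hE'
    simp only [List.nil_append] at *
    obtain ⟨R', h₁, h₂, h₃, h₄⟩ := exists_mem_prune (G := G) (X := X) hER (by omega)
    have hk : k + 1 + c = k + (c + 1) := by omega
    rw [hn]
    refine ⟨O', ?_, ?_, ⟨[], R', O', h₁, rfl, h₃.trans hl, hrev.trans h₄, ?_, ?_, by simp, by simp,
      by simp⟩, h.sorted, fun y hy => (hmono (by omega)).trans (h.ge' y hy),
      fun i hi => ⟨(h.lt_length i hi).1, by have := (h.lt_length i hi).2; omega⟩, ?_⟩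
    · intro _ r hr y hy
      rcases mem_prune hr with rfl | hr
      · simp at hy
      · rw [← hk]; exact h.all hcg.le r hr y hy
    · intro r hr y hy
      rcases mem_prune hr with rfl | hr
      · simp at hy
      · exact (hmono (by omega)).trans (h.ge r hr y hy)
    · rw [← hk]; exact h.all hcg.le R' h₂
    · rw [← hk]; exact hO
    · intro i hi hki hpi
      refine h.price i hi ?_ hpi
      rcases Nat.lt_or_eq_of_le hki with h | rfl
      · exact h
      · omega
  · rw [if_neg hcg]
    set q := level N k with hq
    -- These are the items of this level together with those whose levels were skipped in the gap;
    -- the latter get this lower price.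
    set e := m k - (E ++ O').length with he
    have hm' : (E ++ O').length ≤ m k := by
      by_contra! hlt
      have h₁ := h.lt_length _ hlt
      have h₂ := (hm (m k) k).2 ⟨h₁.1, by omega⟩
      omega
    have hmk : m k ≤ X.1.length := by
      by_contra! hlt
      have := ((hm _ _).1 hlt).1
      omega
    -- As `g ≤ c`, the whole gap lies between `q` and the prices of the completed cycles.
    have hqy : ∀ y, level N (k + 1 + c) ≤ y → G * q ≤ y := fun y hy =>
      (hgrow k).trans ((hmono (by omega)).trans hy)
    have hx : ∀ x ∈ List.replicate e q ++ E, x = q ∨ x ∈ E := fun x hx => by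
      rcases List.mem_append.1 hx with h | h
      · exact .inl (List.eq_of_mem_replicate h)
      · exact .inr h
    have hER₂ : ∀ x ∈ List.replicate e q ++ E, ∀ y ∈ R, G * x ≤ y := fun x hx' y hy => by
      rcases hx x hx' with rfl | h
      · exact hqy y (hR y hy)
      · exact hER' x h y hy
    have hEO₂ : ∀ x ∈ List.replicate e q ++ E, ∀ y ∈ O', G * x ≤ y := fun x hx' y hy => by
      rcases hx x hx' with rfl | h
      · exact hqy y (hO y hy)
      · exact hEO x h y hy
    have hmem : (List.replicate e q ++ E) ++ R ∈ branch X q l :=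
      mem_branch.2 ⟨_, hER, e, by omega, by simp⟩
    have hge : ∀ r ∈ branch X q l, ∀ y ∈ r, q ≤ y := fun r hr y hy => by
      obtain ⟨r', hr', e, -, rfl⟩ := mem_branch.1 hr
      rcases List.mem_append.1 hy with hy | hy
      · rw [List.eq_of_mem_replicate hy]
      · exact (hmono (by omega)).trans (h.ge r' hr' y hy)
    have hge' : ∀ y ∈ (List.replicate e q ++ E) ++ O', q ≤ y := fun y hy => by
      rw [List.append_assoc] at hy
      rcases List.mem_append.1 hy with hy | hy
      · rw [List.eq_of_mem_replicate hy]
      · exact (hmono (by omega)).trans (h.ge' y hy)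
    have hlen' : ((List.replicate e q ++ E) ++ O').length = m k := by
      simp only [List.length_append, List.length_replicate] at *
      omega
    refine ⟨(List.replicate e q ++ E) ++ O', ?_, hge, ?_, ?_, hge', ?_, ?_⟩
    · intro hc' r hr y hy
      -- From a phase `c ≥ g` a phase of at most `g` is reached only by wrapping around.
      have : nextPhase T c = 0 := by
        unfold nextPhase at *; split_ifs at * <;> omega
      rw [this]
      exact hge r hr y hy
    · by_cases hw : c + 1 = T
      · have hn : nextPhase T c = 0 := by simp [nextPhase, hw]
        rw [hn]
        have := revenue_append hG X hl hER₂ hEO₂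
        refine ⟨[], (List.replicate e q ++ E) ++ R, (List.replicate e q ++ E) ++ O', hmem, rfl,
          by simp [hl], ?_, hge _ hmem, hge', by simp, by simp, by simp⟩
        omega
      · have hn : nextPhase T c = c + 1 := by simp [nextPhase, hw]
        have hk : k + 1 + c = k + (c + 1) := by omega
        rw [hn, ← hk]
        exact ⟨_, R, O', hmem, rfl, hl, hrev, hR, hO, fun h => by omega, hER₂, hEO₂⟩
    · rw [List.append_assoc]
      refine List.pairwise_append.2 ⟨?_, h.sorted, fun x hx y hy => ?_⟩
      · simp [List.pairwise_replicate]
      · rw [List.eq_of_mem_replicate hx]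
        exact (hmono (by omega)).trans (h.ge' y hy)
    · rw [hlen']
      exact fun i hi => (hm _ _).1 hi
    · intro i hi hki hpi
      have h₁ : i < m k := (hm _ _).2 ⟨hi, hki⟩
      refine ⟨by omega, ?_⟩
      rw [List.append_assoc, List.reverse_append]
      by_cases hk' : k + 1 ≤ lev i
      · obtain ⟨h₂, h₃⟩ := h.price i hi hk' hpi
        rw [List.getD_append _ _ _ _ (by rwa [List.length_reverse]), h₃]
      · have h₂ : ¬ i < (E ++ O').length := fun h' => hk' (h.lt_length i h').2
        have h₃ : lev i = k := by omega
        rw [List.getD_append_right _ _ _ _ (by rw [List.length_reverse]; omega),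
          List.reverse_replicate, List.length_reverse,
          List.getD_replicate _ (show i - (E ++ O').length < e by omega), h₃]

theorem Follows.run {N G T g : ℕ} (hG : 0 < G) (hgT : g < T)
    (hgrow : ∀ k, G * level N k ≤ level N (k + g)) {X : Input} {lev phase m : ℕ → ℕ}
    (hm : ∀ i k, i < m k ↔ i < X.1.length ∧ k ≤ lev i) {k : ℕ}
    (hp : ∀ j, j + 1 < k → phase j = nextPhase T (phase (j + 1))) {c : ℕ} (hc : c < T)
    (hpc : ∀ j, k = j + 1 → phase j = c)
    {l : List (List ℕ)} {O : List ℕ} (h : Follows N G g X lev phase k c l O) :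
    ∃ c' O', Follows N G g X lev phase 0 c'
      ((levels N k).foldl (sweepStep G T g X) (c, l)).2 O' := by
  induction k generalizing c l O with
  | zero => exact ⟨c, O, h⟩
  | succ k ih =>
    obtain ⟨O', h'⟩ := h.step hG hgT hgrow hm (hpc k rfl)
    rw [levels, List.foldl_cons]
    refine ih (fun j hj => hp j (by omega)) (nextPhase_lt hc) (fun j hj => ?_) h'
    subst hj
    rw [hp j (by omega), hpc _ rfl]

/-- The algorithm finds a price list which is at least as good as the one in which `i` has the price
`level N (lev i)` unless this level is skipped. -/
theorem exists_mem_sweep {N G T g : ℕ} (hG : 0 < G) (hgT : g < T)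
    (hgrow : ∀ k, G * level N k ≤ level N (k + g)) {X : Input} {lev : ℕ → ℕ}
    (hlev : ∀ i j, i ≤ j → j < X.1.length → lev j ≤ lev i) {J c : ℕ} (hJ : ∀ i, lev i ≤ J)
    (hc : c < T) :
    ∃ O, ∃ R ∈ (sweep G T g X c (levels N (J + 1))).2, revenue G X O ≤ revenue G X R ∧
      O.Pairwise (· ≤ ·) ∧ O.length ≤ X.1.length ∧
      ∀ i < X.1.length, g ≤ (c + (J - lev i)) % T →
        i < O.length ∧ O.reverse.getD i 0 = level N (lev i) := by
  classical
  -- By `hlev` the items of level at least `k` form an initial segment; this is its length, the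
  -- function `m` of `Follows.step`.
  have hm : ∀ i k, i < Nat.findGreatest (fun n => ∀ i < n, k ≤ lev i) X.1.length ↔
      i < X.1.length ∧ k ≤ lev i := by
    intro i k
    constructor
    · intro h
      exact ⟨h.trans_le (Nat.findGreatest_le _),
        Nat.findGreatest_spec (P := fun n => ∀ i < n, k ≤ lev i) (m := 0) (Nat.zero_le _)
          (by simp) i h⟩
    · rintro ⟨h₁, h₂⟩
      exact Nat.le_findGreatest (P := fun n => ∀ i < n, k ≤ lev i) (m := i + 1) h₁
        fun j hj => h₂.trans (hlev j i (by omega) h₁)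
  have key : ∃ c' O, Follows N G g X lev (fun k => (c + (J - k)) % T) 0 c'
      (sweep G T g X c (levels N (J + 1))).2 O := by
    -- Levels are visited from `J` downwards starting in phase `c`, so level `k` is met in phase `(c
    -- + (J - k)) % T`. Above `J` there are no items, and the empty list follows itself.
    refine Follows.run hG hgT hgrow hm ?_ hc ?_ (O := []) ?_
    · intro j hj
      have h₁ : c + (J - j) = (c + (J - (j + 1))) + 1 := by omega
      have h₂ := Nat.mod_lt (c + (J - (j + 1))) (show 0 < T by omega)
      rw [h₁, Nat.add_mod, nextPhase]
      generalize (c + (J - (j + 1))) % T = d at *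
      split
      · rcases Nat.lt_or_ge 1 T with h | h
        · rw [Nat.mod_eq_of_lt h]; simp_all
        · have : T = 1 := by omega
          subst this
          omega
      · rw [Nat.mod_eq_of_lt (show 1 < T by omega), Nat.mod_eq_of_lt (by omega)]
    · rintro j hj
      have : j = J := by omega
      subst this
      simpa using Nat.mod_eq_of_lt hc
    · refine ⟨by simp, by simp, ⟨[], [], [], by simp⟩, by simp, by simp, by simp, fun i _ hi => ?_⟩
      have := hJ i
      omega
  obtain ⟨c', O, h⟩ := key
  obtain ⟨E, R, O', hER, rfl, hl, hrev, hR, hO, hE, hER', hEO⟩ := h.split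
  refine ⟨_, _, hER, ?_, h.sorted, ?_, fun i hi hp => h.price i hi (Nat.zero_le _) hp⟩
  · have := revenue_append hG X hl hER' hEO
    omega
  · by_contra! hlt
    exact absurd (h.lt_length _ hlt).1 (lt_irrefl _)

/-! ### From price lists to solutions -/

theorem countP_ofFn {α : Type} {n : ℕ} (f : Fin n → α) (p : α → Prop) [DecidablePred p] :
    (List.ofFn f).countP (fun a => p a) = (Finset.univ.filter fun i => p (f i)).card := by
  rw [Finset.card_filter]
  induction n with
  | zero => simp
  | succ n ih =>
    rw [List.ofFn_succ, List.countP_cons, ih, Fin.sum_univ_succ, Nat.add_comm]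
    simp

theorem forall₂_ofFn {α β : Type} {n : ℕ} {f : Fin n → α} {h : Fin n → β} {P : α → β → Prop} :
    List.Forall₂ P (List.ofFn f) (List.ofFn h) ↔ ∀ i, P (f i) (h i) := by
  induction n with
  | zero => simp
  | succ n ih => rw [List.ofFn_succ, List.ofFn_succ, List.forall₂_cons, ih, Fin.forall_fin_succ]

theorem getD_ofFn {n : ℕ} (f : Fin n → ℕ) (i : Fin n) : (List.ofFn f).getD i 0 = f i := by
  rw [List.getD_eq_getElem _ _ (by simp)]
  simp

namespace Instance

variable (J : Instance)

/-- The instance as input of the algorithm. -/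
def toInput : Input :=
  (List.ofFn J.copies, List.ofFn fun b => List.ofFn fun i => J.value i b)

theorem enc_toInput : Enc.enc J.toInput = J.encode := by
  simp only [toInput, encode, Data.ofFn, enc_mk]
  simp only [Enc.enc, List.map_ofFn, Function.comp_def]

@[simp]
theorem length_toInput_fst : J.toInput.1.length = J.numItems := by simp [toInput]

@[simp]
theorem length_toInput_snd : J.toInput.2.length = J.numBidders := by simp [toInput]

/-- The final state of a bidder. -/
def bidder (G : ℕ) (r : List ℕ) (b : Fin J.numBidders) : Bidder :=
  (exec G J.toInput r).2.2.get (b.cast (by simp))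

theorem ofFn_bidder (G : ℕ) (r : List ℕ) :
    List.ofFn (J.bidder G r) = (exec G J.toInput r).2.2 := by
  refine List.ext_getElem (by simp) fun i h₁ h₂ => ?_
  simp [bidder]

theorem bidder_valid {G : ℕ} (hG : 0 < G) (r : List ℕ) (b : Fin J.numBidders) :
    (J.bidder G r b).Valid G J.toInput r (List.ofFn fun i => J.value i b) := by
  have := exec_valid hG J.toInput r
  rw [← J.ofFn_bidder] at this
  exact forall₂_ofFn.1 this b

theorem revenue_eq (G : ℕ) (r : List ℕ) :
    revenue G J.toInput r = ∑ b, (J.bidder G r b).spent := by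
  rw [revenue, ← J.ofFn_bidder, List.map_ofFn, List.sum_ofFn]
  rfl

/-- Every bidder keeps only the first item bought. -/
def solution (G : ℕ) (r : List ℕ) : Solution J where
  price i := (r.reverse.getD i 0 : ℕ)
  alloc b :=
    if h : (J.bidder G r b).item ≠ 0 ∧ (J.bidder G r b).item - 1 < J.numItems then
      some ⟨(J.bidder G r b).item - 1, h.2⟩
    else none

variable {J}

theorem solution_alloc {G : ℕ} {r : List ℕ} {b : Fin J.numBidders} {i : Fin J.numItems} :
    (J.solution G r).alloc b = some i ↔ (J.bidder G r b).item = i + 1 := by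
  simp only [solution]
  constructor
  · intro h
    split at h
    case isTrue h' =>
      obtain rfl := Option.some.inj h
      simp only
      omega
    case isFalse => simp at h
  · intro h
    have := i.2
    rw [dif_pos ⟨by omega, by omega⟩]
    simp [h]

theorem solution_alloc_none {G : ℕ} (hG : 0 < G) {r : List ℕ} {b : Fin J.numBidders} :
    (J.solution G r).alloc b = none ↔ (J.bidder G r b).item = 0 := by
  simp only [solution]
  constructor
  · intro h
    split at h
    case isTrue h' => simp at h
    case isFalse h' =>
      by_contra h₀
      obtain ⟨i, -, h₁, h₂, -⟩ := (J.bidder_valid hG r b).of_item h₀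
      rw [length_toInput_fst] at h₂
      exact h' ⟨h₀, by omega⟩
  · intro h
    rw [dif_neg (by simp [h])]

theorem alloc_elim_price {G : ℕ} (hG : 0 < G) (r : List ℕ) (b : Fin J.numBidders) :
    ((J.solution G r).alloc b).elim 0 (J.solution G r).price = (J.bidder G r b).first := by
  cases h : (J.solution G r).alloc b with
  | none =>
    rw [solution_alloc_none hG] at h
    simp [(J.bidder_valid hG r b).first_of_item h]
  | some i =>
    rw [solution_alloc] at h
    obtain ⟨j, -, h₁, -, h₂, -⟩ := (J.bidder_valid hG r b).of_item (by omega)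
    have : j = i := by omega
    subst this
    rw [h₂]
    rfl

theorem solution_isFeasible {G : ℕ} (hG : 0 < G) {r : List ℕ} (hr : r.Pairwise (· ≤ ·)) :
    (J.solution G r).IsFeasible where
  price_nonneg i := by simp [solution]
  price_ladder i j hij := by
    simp only [solution, Nat.cast_le]
    by_cases hj : (j : ℕ) < r.reverse.length
    · have hi : (i : ℕ) < r.reverse.length := lt_of_le_of_lt hij hj
      rw [List.getD_eq_getElem _ _ hi, List.getD_eq_getElem _ _ hj]
      rcases eq_or_lt_of_le hij with rfl | h
      · rfl
      · exact List.pairwise_iff_getElem.1 (List.pairwise_reverse.2 hr) _ _ hi hj h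
    · rw [List.getD_eq_default _ _ (by omega)]
      exact Nat.zero_le _
  item_feasible b i h := by
    rw [solution_alloc] at h
    obtain ⟨j, -, h₁, -, h₂, h₃, -⟩ := (J.bidder_valid hG r b).of_item (by omega)
    have : j = i := by omega
    subst this
    rw [getD_ofFn, h₂] at h₃
    simpa [solution] using h₃
  limited_supply i := by
    have h := countP_exec_le hG J.toInput r i
    rw [← J.ofFn_bidder, countP_ofFn _ fun s : Bidder => s.item = i + 1] at h
    simp only [solution_alloc]
    exact h.trans_eq (getD_ofFn J.copies i)

theorem solution_isEncodedBy {G : ℕ} (hG : 0 < G) (r : List ℕ) :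
    (J.solution G r).IsEncodedBy (Enc.enc (output G J.toInput r)) := by
  refine ⟨fun i => r.reverse.getD i 0, fun _ => 1, fun i => by simp [solution], ?_⟩
  simp only [output, enc_mk, Data.ofFn]
  congr 1
  · rw [length_toInput_fst]
    simp only [Enc.enc, List.map_map]
    congr 1
    refine List.ext_getElem (by simp) fun i h₁ h₂ => ?_
    simp
  · rw [← J.ofFn_bidder]
    simp only [Enc.enc, List.map_ofFn]
    congr 2
    funext b
    cases h : (J.solution G r).alloc b with
    | none =>
      rw [solution_alloc_none hG] at h
      simp [h, encodeItem]
    | some i =>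
      rw [solution_alloc] at h
      simp [h, encodeItem]

/-- The profit is the sum of the first prices; the potential of each bidder bounds the total spent
by `G / (G - 1)` times the first price. -/
theorem revenue_mul_le_profit {G : ℕ} (hG : 0 < G) (r : List ℕ) :
    (revenue G J.toInput r * (G - 1 : ℕ) : ℚ) ≤ G * (J.solution G r).profit := by
  have h : revenue G J.toInput r * (G - 1) ≤ G * ∑ b, (J.bidder G r b).first := by
    rw [revenue_eq, Finset.sum_mul, Finset.mul_sum]
    refine Finset.sum_le_sum fun b _ => ?_
    have := (J.bidder_valid hG r b).potential
    omega
  have h' : (J.solution G r).profit = ((∑ b, (J.bidder G r b).first : ℕ) : ℚ) := by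
    rw [Solution.profit, Nat.cast_sum]
    exact Finset.sum_congr rfl fun b _ => alloc_elim_price hG r b
  rw [h']
  exact_mod_cast h

end Instance

/-! ### The approximation ratio -/

theorem mem_candidates {G T g : ℕ} {X : Input} {L : List ℕ} {k : ℕ} {r : List ℕ} :
    r ∈ candidates G T g X L k ↔ ∃ c < k, r ∈ (sweep G T g X c L).2 := by
  induction k with
  | zero => simp [candidates]
  | succ k ih =>
    rw [candidates, List.mem_append, ih]
    constructor
    · rintro (h | ⟨c, hc, h⟩)
      exacts [⟨k, by omega, h⟩, ⟨c, by omega, h⟩]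
    · rintro ⟨c, hc, h⟩
      rcases Nat.lt_succ_iff_lt_or_eq.1 hc with hc | rfl
      exacts [.inr ⟨c, hc, h⟩, .inl h]

theorem select_sorted (N G T g : ℕ) (X : Input) : (select N G T g X).Pairwise (· ≤ ·) := by
  rcases best_mem G X (candidates G T g X (levels N (topLevel N (total X) + 1)) T) with h | h
  · rw [select, h]; exact .nil
  · obtain ⟨c, -, h⟩ := mem_candidates.1 h
    exact sweep_sorted (by simp) _ h

/-- Any `T` consecutive numbers represent every residue once. This counts the starting phases for
which a given level is not skipped. -/
theorem card_filter_mod {T g : ℕ} (d : ℕ) :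
    ((Finset.range T).filter fun c => g ≤ (c + d) % T).card = T - g := by
  have h₁ : ((Finset.range T).filter fun c => g ≤ (c + d) % T).card =
      ((Finset.Ico d (d + T)).filter fun c => g ≤ c % T).card := by
    refine Finset.card_bij (fun c _ => c + d) (by simp; omega) (by simp) fun c hc => ?_
    simp only [Finset.mem_filter, Finset.mem_Ico] at hc
    refine ⟨c - d, ?_, by omega⟩
    simp only [Finset.mem_filter, Finset.mem_range]
    rw [Nat.sub_add_cancel hc.1.1]
    omega
  rw [h₁, Nat.filter_Ico_card_eq_of_periodic _ _ _ fun c => by simp, Nat.count_eq_card_filter_range]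
  have h₂ : (Finset.range T).filter (fun c => g ≤ c % T) = Finset.Ico g T := by
    ext c
    simp only [Finset.mem_filter, Finset.mem_range, Finset.mem_Ico]
    constructor
    · rintro ⟨h, h'⟩; rw [Nat.mod_eq_of_lt h] at h'; omega
    · rintro ⟨h, h'⟩; rw [Nat.mod_eq_of_lt h']; omega
  rw [h₂, Nat.card_Ico]

theorem value_le_total (J : Instance) (i : Fin J.numItems) (b : Fin J.numBidders) :
    J.value i b ≤ total J.toInput := by
  simp only [total, Instance.toInput, List.map_ofFn, List.sum_ofFn, Function.comp_apply]
  calc J.value i b ≤ ∑ i, J.value i b :=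
        Finset.single_le_sum (f := fun i => J.value i b) (by simp) (Finset.mem_univ i)
    _ ≤ _ := Finset.single_le_sum (f := fun b => ∑ i, J.value i b) (by simp) (Finset.mem_univ b)

theorem exists_rounding {N G T g : ℕ} (hN : 0 < N) (hG : 0 < G) (hgT : g < T)
    (hgrow : ∀ k, G * level N k ≤ level N (k + g)) {J : Instance} {S : Solution J}
    (hS : S.IsFeasible) :
    ∃ W : ℕ, S.profit * N ≤ (N + 1) * W ∧
      (T - g) * W ≤ T * (2 * revenue G J.toInput (select N G T g J.toInput)) := by
  set V := total J.toInput with hV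
  set j := topLevel N V with hj
  -- Values are integers, so rounding a price up to an integer keeps it affordable; it is then
  -- rounded down to a level. The cap `j` does not matter for sold items, whose prices are at most
  -- `V < level N j`.
  let lv : Fin J.numItems → ℕ := fun i => Nat.findGreatest (fun k => level N k ≤ ⌈S.price i⌉₊) j
  let lev : ℕ → ℕ := fun i => if h : i < J.numItems then lv ⟨i, h⟩ else 0
  have hlev : ∀ i : Fin J.numItems, lev i = lv i := fun i => by simp [lev]
  have hle : ∀ i, lev i ≤ j := fun i => by
    simp only [lev]
    split
    · exact Nat.findGreatest_le _
    · exact Nat.zero_le _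
  have hanti : ∀ i k, i ≤ k → k < J.toInput.1.length → lev k ≤ lev i := by
    intro i k hik hk
    rw [Instance.length_toInput_fst] at hk
    simp only [lev, hk, hik.trans_lt hk, dif_pos]
    refine Nat.findGreatest_mono_left (fun a ha => ha.trans ?_) _
    exact Nat.ceil_le_ceil (hS.price_ladder _ _ hik)
  have hlv : ∀ i, level N (lv i) ≤ ⌈S.price i⌉₊ := fun i =>
    Nat.findGreatest_spec (P := fun k => level N k ≤ ⌈S.price i⌉₊) (m := 0) (Nat.zero_le _)
      (by simp [level])
  have hval : ∀ b i, S.alloc b = some i → ⌈S.price i⌉₊ ≤ J.value i b := fun b i h =>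
    Nat.ceil_le.2 (hS.item_feasible b i h)
  have hround : ∀ b i, S.alloc b = some i → S.price i * N ≤ (N + 1) * level N (lv i) := by
    intro b i h
    have h₁ : ⌈S.price i⌉₊ < level N (lv i + 1) := by
      by_contra! h'
      rcases Nat.lt_or_ge (lv i) j with h₂ | h₂
      · exact Nat.findGreatest_is_greatest (P := fun k => level N k ≤ ⌈S.price i⌉₊)
          (Nat.lt_succ_self _) h₂ h'
      · have h₃ : V < level N j := lt_level_topLevel N V
        have h₄ := (level_strictMono N).monotone (show j ≤ lv i + 1 by omega)
        have h₅ := hval b i h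
        have h₆ : J.value i b ≤ V := value_le_total J i b
        omega
    rw [level] at h₁
    have h₂ : ⌈S.price i⌉₊ * N ≤ (N + 1) * level N (lv i) := by
      have h₃ := Nat.div_mul_le_self (level N (lv i)) N
      have h₄ : ⌈S.price i⌉₊ ≤ level N (lv i) + level N (lv i) / N := by omega
      calc _ ≤ (level N (lv i) + level N (lv i) / N) * N := by gcongr
        _ ≤ _ := by nlinarith
    calc S.price i * N ≤ (⌈S.price i⌉₊ : ℚ) * N := by
          gcongr; exact Nat.le_ceil _
      _ ≤ _ := by exact_mod_cast h₂
  let w : Fin J.numBidders → ℕ := fun b => (S.alloc b).elim 0 fun i => level N (lv i)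
  let d : Fin J.numBidders → ℕ := fun b => (S.alloc b).elim 0 fun i => j - lv i
  refine ⟨∑ b, w b, ?_, ?_⟩
  · rw [Solution.profit, Nat.cast_sum, Finset.sum_mul, Finset.mul_sum]
    refine Finset.sum_le_sum fun b _ => ?_
    simp only [w]
    cases h : S.alloc b with
    | none => simp
    | some i => simpa using hround b i h
  · have key : ∀ c < T, ∑ b, (if g ≤ (c + d b) % T then w b else 0) ≤
        2 * revenue G J.toInput (select N G T g J.toInput) := by
      intro c hc
      obtain ⟨O, R, hR, hOR, hO, hOn, hOp⟩ := exists_mem_sweep (N := N) (X := J.toInput) hG hgT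
        hgrow hanti hle hc
      rw [Instance.length_toInput_fst] at hOn hOp
      -- The index `J.numItems` stands for no item: it is never below `O.length`. Bidders whose item
      -- has a skipped level are dropped.
      let a : Fin J.numBidders → ℕ := fun b => (S.alloc b).elim J.numItems fun i =>
        if g ≤ (c + (j - lv i)) % T then (i : ℕ) else J.numItems
      have ha : ∀ b, a b < O.length → ∃ i, S.alloc b = some i ∧ a b = i ∧
          O.reverse.getD i 0 = level N (lv i) := by
        intro b hb
        simp only [a] at hb ⊢
        cases h : S.alloc b with
        | none => rw [h] at hb; simp only [Option.elim_none] at hb; omega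
        | some i =>
          rw [h] at hb
          simp only [Option.elim_some] at hb ⊢
          split at hb
          case isTrue h' =>
            refine ⟨i, rfl, by rw [if_pos h'], ?_⟩
            rw [← hlev] at h' ⊢
            exact (hOp i i.2 h').2
          case isFalse => omega
      have h₁ := le_two_mul_revenue (G := G) (X := J.toInput) (as := List.ofFn a) hG hO ?_ ?_
      · rw [List.map_ofFn, List.sum_ofFn] at h₁
        calc _ ≤ _ := Finset.sum_le_sum fun b _ => ?_
          _ ≤ _ := h₁
          _ ≤ _ := by
            have := revenue_le_best (G := G) (X := J.toInput)
              (mem_candidates.2 ⟨c, hc, hR⟩ : R ∈ candidates G T g J.toInput (levels N (j + 1)) T)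
            rw [select, ← hV, ← hj]
            omega
        simp only [w, d, a, Function.comp_apply]
        cases h : S.alloc b with
        | none => simp
        | some i =>
          by_cases h' : g ≤ (c + (j - lv i)) % T
          · have h₄ := hOp i i.2 (by rwa [hlev])
            rw [hlev] at h₄
            simp only [Option.elim_some, h', if_true, h₄.1, h₄.2, le_refl]
          · simp [h']
      · rw [Instance.toInput]
        refine forall₂_ofFn.2 fun b hb => ?_
        obtain ⟨i, h₂, h₃, h₄⟩ := ha b hb
        rw [h₃, h₄, getD_ofFn]
        exact (hlv i).trans (hval b i h₂)
      · intro i hi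
        have h₂ : (i : ℕ) < J.numItems := by omega
        have h₃ : J.toInput.1.getD i 0 = J.copies ⟨i, h₂⟩ := getD_ofFn J.copies ⟨i, h₂⟩
        have h₄ : (List.ofFn a).count i = (Finset.univ.filter fun b => a b = i).card := by
          rw [← countP_ofFn a fun x => x = i, List.count]
          congr 1
        rw [h₃, h₄]
        refine (Finset.card_le_card fun b hb => ?_).trans (hS.limited_supply ⟨i, h₂⟩)
        rw [Finset.mem_filter] at hb ⊢
        obtain ⟨i', h₅, h₆, -⟩ := ha b (by omega)
        have : i' = ⟨i, h₂⟩ := Fin.ext (by rw [← h₆, hb.2])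
        exact ⟨hb.1, this ▸ h₅⟩
    -- Averaging over the starting phases: each bidder's rounded payment survives for exactly `T -
    -- g` of them.
    calc (T - g) * ∑ b, w b = ∑ b, ∑ c ∈ Finset.range T, if g ≤ (c + d b) % T then w b else 0 := by
          rw [Finset.mul_sum]
          refine Finset.sum_congr rfl fun b _ => ?_
          rw [← Finset.sum_filter, Finset.sum_const, card_filter_mod, smul_eq_mul]
      _ = ∑ c ∈ Finset.range T, ∑ b, if g ≤ (c + d b) % T then w b else 0 := Finset.sum_comm
      _ ≤ ∑ c ∈ Finset.range T, 2 * revenue G J.toInput (select N G T g J.toInput) :=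
          Finset.sum_le_sum fun c hc => key c (Finset.mem_range.1 hc)
      _ = _ := by simp

theorem exists_isApproximation {ρ : ℚ} (hρ : 2 < ρ) : ∃ f, IsApproximation ρ f := by
  -- This bound on `k` gives `(ρ - 2) * k ^ 2 ≥ (2 * ρ + 2) * k`, hence `2 * k * (k + 1) ≤ ρ * (k -
  -- 1) ^ 2` at the end.
  obtain ⟨k, hk⟩ := exists_nat_gt ((2 * ρ + 2) / (ρ - 2))
  rw [div_lt_iff₀ (by linarith)] at hk
  have hk1 : 1 < k := by
    by_contra! h
    have : (k : ℚ) ≤ 1 := by exact_mod_cast h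
    nlinarith
  have hk2 : (1 : ℚ) < k := by exact_mod_cast hk1
  have hk0 : 0 < k := by omega
  -- A gap of `k * k` levels multiplies prices by at least `1 + k`, which exceeds the required `G =
  -- k`.
  have hgrow : ∀ j, k * level k j ≤ level k (j + k * k) := fun j => by
    have := level_growth hk0 j (k * k)
    nlinarith
  have hgT : k * k < k * k * k := by nlinarith [Nat.mul_pos hk0 hk0]
  obtain ⟨p, B, ⟨P, hP⟩, hp⟩ := polyTime_output k (X := fun X : Input => X) .id
    (polyTime_select (T := k * k * k) (G := k) hk0 (Nat.mul_pos hk0 hk0))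
  refine ⟨p, P, fun J => ?_⟩
  obtain ⟨t, ht, hr⟩ := hp J.toInput
  have hsz : sz J.toInput = J.encode.size := by rw [sz, J.enc_toInput]
  rw [J.enc_toInput] at hr
  refine ⟨_, t, J.solution k (select k k (k * k * k) (k * k) J.toInput), hr,
    by rw [← hsz]; exact ht.trans (hP _), Instance.solution_isEncodedBy hk0 _,
    Instance.solution_isFeasible hk0 (select_sorted ..), fun S hS => ?_⟩
  obtain ⟨W, h₁, h₂⟩ := exists_rounding hk0 hk0 hgT hgrow hS
  have h₃ := Instance.revenue_mul_le_profit (J := J) hk0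
    (select k k (k * k * k) (k * k) J.toInput)
  set R := revenue k J.toInput (select k k (k * k * k) (k * k) J.toInput)
  set F := (J.solution k (select k k (k * k * k) (k * k) J.toInput)).profit
  have h₄ : ((k : ℚ) - 1) * W ≤ 2 * k * R := by
    have : ((k * k * k - k * k : ℕ) : ℚ) * W ≤ k * k * k * (2 * R) := by exact_mod_cast h₂
    rw [Nat.cast_sub hgT.le] at this
    push_cast at this
    have h₅ : (k * k : ℚ) * ((k - 1) * W) ≤ (k * k) * (2 * k * R) := by linarith
    exact le_of_mul_le_mul_left h₅ (by positivity)
  have h₅ : (R : ℚ) * (k - 1) ≤ k * F := by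
    rwa [Nat.cast_sub hk1.le, Nat.cast_one] at h₃
  have h₆ : 0 ≤ F := by
    have : 0 ≤ (R : ℚ) * (k - 1) := mul_nonneg (by positivity) (by linarith)
    exact nonneg_of_mul_nonneg_right (this.trans h₅) (by linarith)
  have h₇ : ((k : ℚ) - 1) ^ 2 * W ≤ 2 * k ^ 2 * F := by nlinarith
  have h₈ : ((k : ℚ) - 1) ^ 2 * S.profit * k ≤ (k + 1) * (2 * k ^ 2 * F) := by
    calc _ = ((k : ℚ) - 1) ^ 2 * (S.profit * k) := by ring
      _ ≤ ((k : ℚ) - 1) ^ 2 * ((k + 1) * W) := by gcongr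
      _ = (k + 1) * (((k : ℚ) - 1) ^ 2 * W) := by ring
      _ ≤ _ := by gcongr
  have h₉ : ((k : ℚ) - 1) ^ 2 * S.profit ≤ 2 * k * (k + 1) * F := by
    refine le_of_mul_le_mul_right (a := (k : ℚ)) ?_ (by linarith)
    linarith
  have h₁₀ : 2 * (k : ℚ) * (k + 1) ≤ ρ * (k - 1) ^ 2 := by nlinarith
  refine le_of_mul_le_mul_left (a := ((k : ℚ) - 1) ^ 2) ?_ (by nlinarith)
  calc _ ≤ _ := h₉
    _ ≤ ρ * (k - 1) ^ 2 * F := by gcongr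
    _ = _ := by ring

end MaxBuying

theorem mainTheorem3 (t : ℕ) (ht : 0 < t) (α : ℚ) (hα : 1 < α) :
    ∃ f : BitCost.Prog,
      MaxBuying.IsApproximation (α * (α ^ t - 1 + α ^ (t - 1)) / (α ^ t - 1)) f := by
  apply MaxBuying.exists_isApproximation
  have h₁ : 1 < α ^ t := one_lt_pow₀ hα ht.ne'
  have h₂ : α * α ^ (t - 1) = α ^ t := by rw [← pow_succ', Nat.sub_add_cancel ht]
  -- What remains after clearing the denominator is `0 < (α ^ t - 1) * (α - 1) + 1`.
  rw [lt_div_iff₀ (by linarith), mul_add, h₂]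
  nlinarith
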